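/- Let $X$ be the compact abelian group \[ X=\{x=(x_{i,j,k})\in\mathbb{F}_2^{\mathbb{Z}^3} : x_{i,j,k}+x_{i+1,j,k}+x_{i,j+1,k}=0 \text{ for all } (i,j,k)\in\mathbb{Z}^3\} \] (a closed subgroup of $\mathbb{F}_2^{\mathbb{Z}^3}$ with the product topology), and let $\alpha$ be the $\mathbb{Z}^3$-action on $X$ obtained by restricting the full $\mathbb{Z}^3$-shift. For a subgroup $\Lambda\subset\mathbb{Z}^3$ of finite index $[\Lambda]=|\mathbb{Z}^3/\Lambda|$ let $\mathsf{F}_\alpha(\Lambda)$ be the number of points $x\in X$ with $\alpha^{\mathbf n}(x)=x$ for all $\mathbf n\in\Lambda$. Let \[ \zeta_\alpha(z)=\exp\Bigl(\sum_{\Lambda}\frac{\mathsf{F}_\alpha(\Lambda)}{[\Lambda]}z^{[\Lambda]}\Bigr) \] be the dynamical zeta function of $\alpha$, a formal power series in which $\Lambda$ runs through the subgroups of finite index in $\mathbb{Z}^3$; let $\mathsf{g}(\alpha)=\limsup_{[\Lambda]\to\infty}\frac{1}{[\Lambda]}\log\mathsf{F}_\alpha(\Lambda)$ be the upper growth rate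 of periodic points, and let $\mathsf{h}(\alpha)$ be the topological entropy of $\alpha$. Then: 1. $\mathsf{F}_\alpha(\Lambda)$ is finite for every subgroup $\Lambda$ of finite index; 2. $\mathsf{h}(\alpha)=0$; 3. $\mathsf{g}(\alpha)=\frac{2}{3}\log 2$; 4. $\zeta_\alpha$ has radius of convergence $e^{-\mathsf{g}(\alpha)}=2^{-2/3}$; 5. $\zeta_\alpha$ has a continuation from the disk $|z|<2^{-2/3}$ to the open unit disk that is analytic except for poles (a meromorphic function on $|z|<1$); 6. the poles of this continuation accumulate at every point of the unit circle; 7. the unit circle is a natural boundary: no point of the unit circle has a neighbourhood to which the continuation of $\zeta_\alpha$ extends meromorphically (in particular, none to which it extends analytically). -/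

import Mathlib

open Set Filter Topology
open scoped ENNReal

noncomputable section

namespace LindZeta

/-! ### Actions of `ℤ^d`: periodic points, zeta function, growth rate, topological entropy -/

/-- There are only finitely many subgroups of `ℤ^d` of a given finite index, so that the finite sum
in the definition of `logZeta` below is a genuine one. -/
theorem finite_index_eq (d n : ℕ) :
    {Λ : AddSubgroup (Fin d → ℤ) | Λ.FiniteIndex ∧ Λ.index = n}.Finite := by
  rcases Nat.eq_zero_or_pos n with rfl | hn
  · convert Set.finite_empty
    ext Λ
    simp only [mem_ofPred_eq, mem_empty_iff_false, iff_false, not_and]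
    exact fun h => h.index_ne_zero
  have : NeZero n := ⟨hn.ne'⟩
  let f : (Fin d → ℤ) →+ (Fin d → ZMod n) := (Int.castAddHom (ZMod n)).compLeft (Fin d)
  refine Set.Finite.subset (Set.finite_range (AddSubgroup.comap f)) ?_
  rintro Λ ⟨-, hΛ⟩
  refine ⟨Λ.map f, ?_⟩
  rw [AddSubgroup.comap_map_eq, sup_eq_left]
  intro v hv
  have hdvd : ∀ i, (n : ℤ) ∣ v i := fun i =>
    (ZMod.intCast_zmod_eq_zero_iff_dvd (v i) n).1 (congrFun hv i)
  choose w hw using hdvd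
  have : v = n • w := by
    ext i
    simp [hw i]
  rw [this, ← hΛ]
  exact AddSubgroup.nsmul_index_mem Λ w

section Action

variable (d : ℕ) (X : Type*) [AddAction (Fin d → ℤ) X]

/-- `F(Λ)`: the number of points of `X` that are fixed by every element of `Λ`. -/
def periodicCount (Λ : AddSubgroup (Fin d → ℤ)) : ℕ :=
  Nat.card (AddAction.fixedPoints Λ X)

/-- The formal power series `∑_Λ F(Λ) / [Λ] z^[Λ]`, where `Λ` runs through the subgroups of finite
index `[Λ]` in `ℤ^d`. -/
def logZeta : PowerSeries ℂ :=
  PowerSeries.mk fun n =>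
    ∑ᶠ Λ ∈ {Λ : AddSubgroup (Fin d → ℤ) | Λ.FiniteIndex ∧ Λ.index = n},
      (periodicCount d X Λ : ℂ) / (Λ.index : ℂ)

/-- The dynamical zeta function `exp (∑_Λ F(Λ) / [Λ] z^[Λ])`, as a formal power series. -/
def zeta : PowerSeries ℂ :=
  (PowerSeries.exp ℂ).subst (logZeta d X)

/-- The radius of convergence of the power series `zeta`. -/
def zetaRadius : ℝ≥0∞ :=
  (FormalMultilinearSeries.ofScalars ℂ fun n => PowerSeries.coeff n (zeta d X)).radius

/-- The upper growth rate of periodic points, `limsup_{[Λ] → ∞} (1 / [Λ]) log F(Λ)`. -/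
def upperGrowthRate : EReal :=
  limsup (fun Λ : {Λ : AddSubgroup (Fin d → ℤ) // Λ.FiniteIndex} =>
      ENNReal.log (periodicCount d X Λ.1 : ℝ≥0∞) / (Λ.1.index : EReal))
    (comap (fun Λ : {Λ : AddSubgroup (Fin d → ℤ) // Λ.FiniteIndex} => Λ.1.index) atTop)

variable {d X} in
/-- The common refinement `⋁_{m ∈ Q} α^{-m} 𝒰` of the translates of a cover `𝒰`. -/
def refinement (𝒰 : Set (Set X)) (Q : Finset (Fin d → ℤ)) : Set (Set X) :=
  {V | ∃ c : (Fin d → ℤ) → Set X, (∀ m ∈ Q, c m ∈ 𝒰) ∧ V = ⋂ m ∈ Q, (fun x => m +ᵥ x) ⁻¹' c m}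

variable {X} in
/-- The least number of members of `𝒱` that cover the whole space. -/
def minSubcover (𝒱 : Set (Set X)) : ℕ∞ :=
  ⨅ s ∈ {s : Set (Set X) | s ⊆ 𝒱 ∧ ⋃₀ s = univ}, s.encard

/-- The box `{0, …, n - 1}^d`. -/
def box (n : ℕ) : Finset (Fin d → ℤ) :=
  Fintype.piFinset fun _ => Finset.Ico (0 : ℤ) n

/-- The topological entropy of an action of `ℤ^d` by homeomorphisms of a compact space: the supremum
over the open covers `𝒰` of the exponential growth rate of the size of the smallest subcover of
`⋁_{m ∈ Q} α^{-m} 𝒰`, where `Q` runs through the boxes `{0, …, n - 1}^d`. -/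
def topologicalEntropy [TopologicalSpace X] [CompactSpace X] [ContinuousConstVAdd (Fin d → ℤ) X] :
    EReal :=
  ⨆ 𝒰 ∈ {𝒰 : Set (Set X) | (∀ U ∈ 𝒰, IsOpen U) ∧ ⋃₀ 𝒰 = univ},
    limsup (fun n : ℕ =>
      ENNReal.log (minSubcover (refinement 𝒰 (box d n)) : ℝ≥0∞) / ((box d n).card : EReal)) atTop

end Action

/-! ### Natural boundaries -/

/-- The boundary of `U` is a natural boundary for the meromorphic function `f` on `U`: there is no
disc around a boundary point to which `f` can be continued meromorphically (and, all the less,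
holomorphically). The values of a meromorphic function at isolated points are disregarded. -/
def HasNaturalBoundary (f : ℂ → ℂ) (U : Set ℂ) : Prop :=
  ∀ w ∈ frontier U, ∀ r > 0, ∀ g : ℂ → ℂ, MeromorphicOn g (Metric.ball w r) →
    ¬ g =ᶠ[codiscreteWithin (Metric.ball w r ∩ U)] f

/-! ### The shift extension of Ledrappier's example -/

/-- The compact group of all `x ∈ 𝔽₂^(ℤ^3)` with
`x_(i,j,k) + x_(i+1,j,k) + x_(i,j+1,k) = 0` for all `(i,j,k)`; it has the topology induced by the
product topology. -/
def ledrappierExt : AddSubgroup ((Fin 3 → ℤ) → ZMod 2) where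
  carrier := {x | ∀ i j k : ℤ, x ![i, j, k] + x ![i + 1, j, k] + x ![i, j + 1, k] = 0}
  zero_mem' := by simp
  add_mem' := by
    intro x y hx hy i j k
    have h₁ := hx i j k
    have h₂ := hy i j k
    simp only [Pi.add_apply]
    linear_combination h₁ + h₂
  neg_mem' := by
    intro x hx i j k
    have h₁ := hx i j k
    simp only [Pi.neg_apply]
    linear_combination -h₁

/-- The shift action of `ℤ^3`, given by `(n · x)_m = x_(m + n)`. -/
instance : AddAction (Fin 3 → ℤ) ledrappierExt where
  vadd n x := ⟨fun m => x.1 (m + n), fun i j k => by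
    have e : ∀ a b c : ℤ, ![a, b, c] + n = ![a + n 0, b + n 1, c + n 2] := by
      intro a b c
      ext t
      fin_cases t <;> simp
    have h := x.2 (i + n 0) (j + n 1) (k + n 2)
    beta_reduce
    rw [e, e, e, add_right_comm i 1, add_right_comm j 1]
    exact h⟩
  zero_vadd x := Subtype.ext (funext fun m => congrArg x.1 (add_zero m))
  add_vadd n n' x := Subtype.ext (funext fun m => congrArg x.1 (add_assoc m n n').symm)

instance : ContinuousConstVAdd (Fin 3 → ℤ) ledrappierExt where
  continuous_const_vadd n :=
    continuous_induced_rng.2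
      (continuous_pi fun m => (continuous_apply (m + n)).comp continuous_subtype_val)

instance : CompactSpace ledrappierExt := by
  refine isCompact_iff_compactSpace.1 (IsClosed.isCompact ?_)
  have : (ledrappierExt : Set ((Fin 3 → ℤ) → ZMod 2)) = ⋂ (i : ℤ) (j : ℤ) (k : ℤ),
      {x | x ![i, j, k] + x ![i + 1, j, k] + x ![i, j + 1, k] = 0} := by
    ext x
    simp [ledrappierExt]
  rw [this]
  exact isClosed_iInter fun i => isClosed_iInter fun j => isClosed_iInter fun k =>
    isClosed_eq (by fun_prop) continuous_const

end LindZeta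

end

/-! Write `ℤ^3` as `ℤ^2 × ℤ`. A subgroup `Λ` of finite index is given by its intersection `K` with
`ℤ^2`, the generator `c > 0` of its projection to `ℤ`, and a coset `t` in `ℤ^2 / K` lying over `c`;
its index is `[K] c`. The defining relation acts within horizontal layers, so a `Λ`-periodic point
is a free choice of `c` layers, each a `K`-periodic point of Ledrappier's planar system: `F(Λ) =
F(K)^c`. The `[K]` choices of `t` cancel a factor `1 / [K]`, the sum over `c` is a logarithm series,
and `ζ` is the product of the `1 / (1 - F(K) z^[K])`.

Everything else follows from estimates of `F(K)`. A dimension count on `ℤ^2 / K` gives `F(K)^3 ≤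
4^[K]` (`three_mul_finrank_ker_threeDot_le`), with equality for the kernel of `(a, b) ↦ a - b` mod
3; this yields the growth rate and the radius of convergence. By the pigeonhole principle two
monomials of small degree are congruent modulo `K`, which gives `F(K) ≤ 4^√[K]`
(`planeCount_le_sqrt`), so the product defining `1 / ζ` converges on the whole unit disc. Finally
`F(K) ≥ 4` for some `K` of arbitrarily large index `m`. The zeros of `1 - F(K) z^m` form a regular
`m`-gon of radius `F(K)^(-1/m)`, which tends to 1 by the square-root bound. Hence poles accumulate
at every point of the circle, and a meromorphic function has no accumulation of poles inside its
domain.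

The entropy vanishes because a cube of side `n` is determined by `O(n^2)` coordinates. -/

noncomputable section

namespace LindZeta

/-! ### Subgroups of finite index in `A × ℤ` -/

section Tower

variable {A : Type*} [AddCommGroup A]

/-- The subgroup of `A × ℤ` that meets `A × 0` in `K`, projects onto `c ℤ`, and contains `(a, c)`
for the members `a` of the coset `t`. -/
def tower (K : AddSubgroup A) (c : ℕ) (t : A ⧸ K) : AddSubgroup (A × ℤ) where
  carrier := {p | ∃ q : ℤ, p.2 = q * c ∧ (p.1 : A ⧸ K) = q • t}
  zero_mem' := ⟨0, by simp⟩
  add_mem' := by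
    rintro a b ⟨q, h₁, h₂⟩ ⟨r, h₃, h₄⟩
    refine ⟨q + r, ?_, ?_⟩
    · rw [Prod.snd_add, h₁, h₃, add_mul]
    · rw [Prod.fst_add, QuotientAddGroup.mk_add, h₂, h₄, add_smul]
  neg_mem' := by
    rintro a ⟨q, h₁, h₂⟩
    refine ⟨-q, ?_, ?_⟩
    · rw [Prod.snd_neg, h₁, neg_mul]
    · rw [Prod.fst_neg, QuotientAddGroup.mk_neg, h₂, neg_smul]

theorem mem_tower {K : AddSubgroup A} {c : ℕ} {t : A ⧸ K} {p : A × ℤ} :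
    p ∈ tower K c t ↔ ∃ q : ℤ, p.2 = q * c ∧ (p.1 : A ⧸ K) = q • t := Iff.rfl

theorem mem_tower_zero {K : AddSubgroup A} {c : ℕ} (hc : 0 < c) {t : A ⧸ K} {a : A} :
    (a, (0 : ℤ)) ∈ tower K c t ↔ a ∈ K := by
  rw [mem_tower]
  constructor
  · rintro ⟨q, h₁, h₂⟩
    have : q = 0 := by
      rcases mul_eq_zero.1 h₁.symm with h | h
      · exact h
      · exact absurd (Int.natCast_eq_zero.1 h) hc.ne'
    rw [this, zero_smul] at h₂
    exact (QuotientAddGroup.eq_zero_iff a).1 h₂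
  · exact fun h => ⟨0, by simp, by simpa using (QuotientAddGroup.eq_zero_iff a).2 h⟩

theorem comap_inl_tower {K : AddSubgroup A} {c : ℕ} (hc : 0 < c) (t : A ⧸ K) :
    (tower K c t).comap (AddMonoidHom.inl A ℤ) = K := by
  ext a
  exact mem_tower_zero hc

theorem map_snd_tower (K : AddSubgroup A) (c : ℕ) (t : A ⧸ K) :
    (tower K c t).map (AddMonoidHom.snd A ℤ) = AddSubgroup.zmultiples (c : ℤ) := by
  ext k
  rw [AddSubgroup.mem_map, AddSubgroup.mem_zmultiples_iff]
  constructor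
  · rintro ⟨p, ⟨q, h, -⟩, rfl⟩
    exact ⟨q, by rw [smul_eq_mul]; exact h.symm⟩
  · rintro ⟨q, rfl⟩
    obtain ⟨a, ha⟩ := QuotientAddGroup.mk_surjective (q • t)
    exact ⟨(a, q • (c : ℤ)), ⟨q, by simp, ha⟩, rfl⟩

/-- The index is multiplicative along `Λ ≤ Λ + A × 0 ≤ A × ℤ`: the lower step is seen in `A`, the
upper one in `ℤ`. -/
theorem index_prod_int (Λ : AddSubgroup (A × ℤ)) :
    Λ.index = (Λ.comap (AddMonoidHom.inl A ℤ)).index * (Λ.map (AddMonoidHom.snd A ℤ)).index := by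
  have hker : (AddMonoidHom.snd A ℤ).ker = (AddMonoidHom.inl A ℤ).range := by
    ext ⟨a, k⟩
    rw [AddMonoidHom.mem_ker]
    simp [eq_comm]
  rw [AddSubgroup.index_map, AddMonoidHom.range_eq_top_of_surjective _ Prod.snd_surjective,
    AddSubgroup.index_top, mul_one, AddSubgroup.index_comap, ← hker,
    ← AddSubgroup.relIndex_sup_right, sup_comm, AddSubgroup.relIndex_mul_index le_sup_left]

theorem index_tower {K : AddSubgroup A} {c : ℕ} (hc : 0 < c) (t : A ⧸ K) :
    (tower K c t).index = K.index * c := by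
  rw [index_prod_int, comap_inl_tower hc, map_snd_tower, Int.index_zmultiples, Int.natAbs_natCast]

theorem exists_tower (Λ : AddSubgroup (A × ℤ)) (hΛ : Λ.index ≠ 0) :
    ∃ (K : AddSubgroup A) (c : ℕ) (t : A ⧸ K), K.index ≠ 0 ∧ 0 < c ∧ Λ = tower K c t := by
  rw [index_prod_int] at hΛ
  obtain ⟨b, hb⟩ := (Int.subgroup_cyclic (Λ.map (AddMonoidHom.snd A ℤ)))
  rw [← AddSubgroup.zmultiples_eq_closure] at hb
  have hb0 : b.natAbs ≠ 0 := by
    rw [hb, Int.index_zmultiples] at hΛ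
    exact right_ne_zero_of_mul hΛ
  have hbb : AddSubgroup.zmultiples (b.natAbs : ℤ) = AddSubgroup.zmultiples b := by
    ext k
    rw [Int.mem_zmultiples_iff, Int.mem_zmultiples_iff, Int.natAbs_dvd]
  have hmem : (b.natAbs : ℤ) ∈ Λ.map (AddMonoidHom.snd A ℤ) := by
    rw [hb, ← hbb]
    exact AddSubgroup.mem_zmultiples _
  obtain ⟨⟨a, k⟩, ha, hk⟩ := hmem
  change k = _ at hk
  subst hk
  refine ⟨Λ.comap (AddMonoidHom.inl A ℤ), b.natAbs, (a : A ⧸ _), left_ne_zero_of_mul hΛ,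
    Nat.pos_of_ne_zero hb0, ?_⟩
  -- Subtracting `q` times the chosen element `(a, |b|)` of `Λ` brings a point at height `q |b|`
  -- down to height 0, where membership is decided by `K`.
  have key : ∀ (q : ℤ) (x : A), (x, q * (b.natAbs : ℤ)) ∈ Λ ↔
      x - q • a ∈ Λ.comap (AddMonoidHom.inl A ℤ) := by
    intro q x
    rw [AddSubgroup.mem_comap]
    have h : (x, q * (b.natAbs : ℤ)) =
        AddMonoidHom.inl A ℤ (x - q • a) + q • (a, (b.natAbs : ℤ)) := by
      simp
    rw [h]
    exact AddSubgroup.add_mem_cancel_right _ (Λ.zsmul_mem ha q)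
  have key' : ∀ (q : ℤ) (x : A), x - q • a ∈ Λ.comap (AddMonoidHom.inl A ℤ) ↔
      (x : A ⧸ Λ.comap (AddMonoidHom.inl A ℤ)) = q • (a : A ⧸ _) := by
    intro q x
    rw [← QuotientAddGroup.eq_zero_iff, QuotientAddGroup.mk_sub, QuotientAddGroup.mk_zsmul,
      sub_eq_zero]
  ext ⟨x, k⟩
  rw [mem_tower]
  constructor
  · intro h
    have : k ∈ AddSubgroup.zmultiples (b.natAbs : ℤ) := by
      rw [hbb, ← hb]
      exact ⟨_, h, rfl⟩
    obtain ⟨q, hq⟩ := AddSubgroup.mem_zmultiples_iff.1 this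
    rw [smul_eq_mul] at hq
    exact ⟨q, hq.symm, (key' q x).1 ((key q x).1 (hq ▸ h))⟩
  · rintro ⟨q, h₁, h₂⟩
    dsimp only at h₁ h₂
    rw [h₁]
    exact (key q x).2 ((key' q x).2 h₂)

variable (A) in
/-- The subgroups of finite index. -/
abbrev FinIdx := {K : AddSubgroup A // K.index ≠ 0}

variable (A) in
/-- The data that determine a subgroup of finite index in `A × ℤ`. -/
abbrev TowerData := Σ K : FinIdx A, ℕ × (A ⧸ K.1)

/-- The subgroup given by its data; here `c + 1` generates the projection to `ℤ`. -/
def ofTowerData (x : TowerData A) : FinIdx (A × ℤ) :=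
  ⟨tower x.1.1 (x.2.1 + 1) x.2.2, by
    rw [index_tower x.2.1.succ_pos]
    exact mul_ne_zero x.1.2 x.2.1.succ_ne_zero⟩

theorem index_ofTowerData (x : TowerData A) :
    (ofTowerData x).1.index = x.1.1.index * (x.2.1 + 1) :=
  index_tower x.2.1.succ_pos _

/-- For injectivity, `K` is recovered as the intersection with `A × 0`, then `c` from the index, and
`t` as the coset over the generator of the projection. -/
theorem bijective_ofTowerData : Function.Bijective (ofTowerData (A := A)) := by
  constructor
  · rintro ⟨⟨K, hK⟩, c, t⟩ ⟨⟨K', hK'⟩, c', t'⟩ h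
    have h' : tower K (c + 1) t = tower K' (c' + 1) t' := congrArg Subtype.val h
    have e₁ := congrArg (AddSubgroup.comap (AddMonoidHom.inl A ℤ)) h'
    rw [comap_inl_tower c.succ_pos, comap_inl_tower c'.succ_pos] at e₁
    subst e₁
    have e₂ := congrArg AddSubgroup.index h'
    rw [index_tower c.succ_pos, index_tower c'.succ_pos] at e₂
    have e₃ := mul_left_cancel₀ hK e₂
    obtain rfl : c = c' := by omega
    have e₄ : t = t' := by
      obtain ⟨a, rfl⟩ := QuotientAddGroup.mk_surjective t
      have : (a, ((c + 1 : ℕ) : ℤ)) ∈ tower K (c + 1) (a : A ⧸ K) := ⟨1, by simp⟩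
      rw [h'] at this
      obtain ⟨q, h₁, h₂⟩ := this
      have hq : q = 1 := by
        have h₃ : ((c + 1 : ℕ) : ℤ) ≠ 0 := by positivity
        exact (mul_right_cancel₀ h₃ ((one_mul _).trans h₁)).symm
      rw [hq, one_smul] at h₂
      exact h₂
    subst e₄
    rfl
  · rintro ⟨Λ, hΛ⟩
    obtain ⟨K, c, t, hK, hc, rfl⟩ := exists_tower Λ hΛ
    obtain ⟨c, rfl⟩ := Nat.exists_eq_succ_of_ne_zero hc.ne'
    exact ⟨⟨⟨K, hK⟩, c, t⟩, rfl⟩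

variable (A) in
/-- The subgroups of finite index in `A × ℤ` correspond to their data. -/
def towerEquiv : TowerData A ≃ FinIdx (A × ℤ) :=
  Equiv.ofBijective _ bijective_ofTowerData

end Tower

/-- There are few subgroups of finite index in `ℤ × ℤ`: they are numbered by triples of natural
numbers whose sum is at most three times the index. -/
theorem exists_injective_finIdx :
    ∃ φ : FinIdx (ℤ × ℤ) → ℕ × ℕ × ℕ, Function.Injective φ ∧
      ∀ K, (φ K).1 + (φ K).2.1 + (φ K).2.2 ≤ 3 * K.1.index := by
  have hfin : ∀ K : FinIdx ℤ, Finite (ℤ ⧸ K.1) := fun K =>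
    have : K.1.FiniteIndex := ⟨K.2⟩
    AddSubgroup.finite_quotient_of_finiteIndex
  -- The same decomposition, one dimension lower: a finite-index subgroup of `ℤ` is known by its
  -- index `m`, and the cosets are numbered by `i < m`. The bound is then `m + c + i ≤ 3 m (c + 1)`.
  let ψ : TowerData ℤ → ℕ × ℕ × ℕ := fun x =>
    (x.1.1.index, x.2.1, (Finite.equivFin (ℤ ⧸ x.1.1) x.2.2).val)
  have hψ : Function.Injective ψ := by
    rintro ⟨⟨K, hK⟩, c, t⟩ ⟨⟨K', hK'⟩, c', t'⟩ h
    have h₁ : K.index = K'.index := congrArg Prod.fst h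
    have h₂ : c = c' := congrArg (fun p => p.2.1) h
    have hKK : K = K' := by
      obtain ⟨a, rfl⟩ := Int.subgroup_cyclic K
      obtain ⟨b, rfl⟩ := Int.subgroup_cyclic K'
      rw [← AddSubgroup.zmultiples_eq_closure, ← AddSubgroup.zmultiples_eq_closure,
        Int.index_zmultiples, Int.index_zmultiples] at h₁
      rw [← AddSubgroup.zmultiples_eq_closure, ← AddSubgroup.zmultiples_eq_closure]
      ext k
      rw [Int.mem_zmultiples_iff, Int.mem_zmultiples_iff, ← Int.natAbs_dvd, h₁, Int.natAbs_dvd]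
    subst hKK h₂
    have := hfin ⟨K, hK⟩
    have h₃ := congrArg (fun p => p.2.2) h
    have h₄ : t = t' := (Finite.equivFin (ℤ ⧸ K)).injective (Fin.ext h₃)
    subst h₄
    rfl
  refine ⟨ψ ∘ (towerEquiv ℤ).symm, hψ.comp (towerEquiv ℤ).symm.injective, fun L => ?_⟩
  obtain ⟨x, rfl⟩ := (towerEquiv ℤ).surjective L
  rw [Function.comp_apply, Equiv.symm_apply_apply]
  have h₁ : ((towerEquiv ℤ) x).1.index = x.1.1.index * (x.2.1 + 1) := index_ofTowerData x
  rw [h₁]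
  have h₂ : (ψ x).2.2 < x.1.1.index := (Finite.equivFin (ℤ ⧸ x.1.1) x.2.2).isLt
  change x.1.1.index + x.2.1 + (ψ x).2.2 ≤ _
  have h₃ : 0 < x.1.1.index := Nat.pos_of_ne_zero x.1.2
  nlinarith

/-! ### Periodic points of Ledrappier's example in the plane -/

section Rank

variable {G : Type*} [AddCommGroup G]

/-- The operator `f ↦ f + f(· + u) + f(· + v)`. -/
def threeDot (u v : G) : (G → ZMod 2) →ₗ[ZMod 2] (G → ZMod 2) where
  toFun f g := f g + f (g + u) + f (g + v)
  map_add' f f' := by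
    funext g
    simp only [Pi.add_apply]
    ring
  map_smul' c f := by
    funext g
    simp only [Pi.smul_apply, smul_eq_mul, RingHom.id_apply]
    ring

theorem threeDot_apply (u v : G) (f : G → ZMod 2) (g : G) :
    threeDot u v f g = f g + f (g + u) + f (g + v) := rfl

/-- The translates of `1 + u + v` that form a basis of the ideal that it generates have supports
that cover the group, so that the dimension of the ideal is at least a third of its order. -/
theorem three_mul_finrank_ker_threeDot_le [Finite G] (u v : G) :
    3 * Module.finrank (ZMod 2) (LinearMap.ker (threeDot u v)) ≤ 2 * Nat.card G := by
  classical
  have := Fintype.ofFinite G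
  let φ : G → Module.Dual (ZMod 2) (G → ZMod 2) := fun g => LinearMap.proj g ∘ₗ threeDot u v
  -- `κ` indexes a basis, chosen among the translated forms `φ g`, of the space that they span; its
  -- size is the rank of the operator.
  obtain ⟨κ, a, ha, hspan, hli⟩ := exists_linearIndependent' (ZMod 2) φ
  have : Finite κ := Finite.of_injective a ha
  have := Fintype.ofFinite κ
  have hker : LinearMap.ker (threeDot u v) =
      (Submodule.span (ZMod 2) (range (φ ∘ a))).dualCoannihilator := by
    rw [hspan]
    ext f
    rw [Submodule.mem_dualCoannihilator, LinearMap.mem_ker]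
    constructor
    · intro hf ψ hψ
      induction hψ using Submodule.span_induction with
      | mem x hx =>
        obtain ⟨g, rfl⟩ := hx
        exact congrFun hf g
      | zero => rfl
      | add x y _ _ hx hy => rw [LinearMap.add_apply, hx, hy, add_zero]
      | smul c x _ hx => rw [LinearMap.smul_apply, hx, smul_zero]
    · intro h
      funext g
      exact h (φ g) (Submodule.subset_span (mem_range_self g))
  have hcard : Fintype.card κ + Module.finrank (ZMod 2) (LinearMap.ker (threeDot u v)) =
      Nat.card G := by
    rw [hker, ← finrank_span_eq_card hli, Subspace.finrank_add_finrank_dualCoannihilator_eq,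
      Module.finrank_fintype_fun_eq_card, Nat.card_eq_fintype_card]
  suffices h : Nat.card G ≤ 3 * Fintype.card κ by omega
  by_contra! hlt
  let S : Finset G := Finset.univ.image a ∪ Finset.univ.image (fun k => a k + u) ∪
    Finset.univ.image (fun k => a k + v)
  have hS : S.card < Fintype.card G := by
    rw [← Nat.card_eq_fintype_card]
    refine lt_of_le_of_lt ?_ hlt
    refine (Finset.card_union_le _ _).trans ?_
    have h₁ := Finset.card_union_le (Finset.univ.image a) (Finset.univ.image (fun k => a k + u))
    have h₂ : (Finset.univ.image a).card ≤ Fintype.card κ := Finset.card_image_le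
    have h₃ : (Finset.univ.image (fun k => a k + u)).card ≤ Fintype.card κ := Finset.card_image_le
    have h₄ : (Finset.univ.image (fun k => a k + v)).card ≤ Fintype.card κ := Finset.card_image_le
    omega
  obtain ⟨h, hh⟩ : ∃ h, h ∉ S := by
    by_contra! hall
    exact hS.ne (by rw [Finset.eq_univ_of_forall hall, Finset.card_univ])
  simp only [S, Finset.mem_union, Finset.mem_image, Finset.mem_univ, true_and, not_or,
    not_exists] at hh
  -- The delta function at the uncovered point `h` is killed by the basis forms, hence by all. But
  -- the values of its image sum to `1 + 1 + 1 ≠ 0` in `𝔽₂`.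
  have hmem : Pi.single h (1 : ZMod 2) ∈ LinearMap.ker (threeDot u v) := by
    rw [hker, Submodule.mem_dualCoannihilator]
    intro ψ hψ
    induction hψ using Submodule.span_induction with
    | mem x hx =>
      obtain ⟨k, rfl⟩ := hx
      change threeDot u v (Pi.single h 1) (a k) = 0
      rw [threeDot_apply, Pi.single_eq_of_ne (hh.1.1 k), Pi.single_eq_of_ne (hh.1.2 k),
        Pi.single_eq_of_ne (hh.2 k)]
      rfl
    | zero => rfl
    | add x y _ _ hx hy => rw [LinearMap.add_apply, hx, hy, add_zero]
    | smul c x _ hx => rw [LinearMap.smul_apply, hx, smul_zero]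
  have hsum : ∑ g, threeDot u v (Pi.single h 1) g = 0 := by
    rw [LinearMap.mem_ker.1 hmem]
    simp
  simp only [threeDot_apply, Finset.sum_add_distrib] at hsum
  have hu := Equiv.sum_comp (Equiv.addRight u) (Pi.single h (1 : ZMod 2))
  have hv := Equiv.sum_comp (Equiv.addRight v) (Pi.single h (1 : ZMod 2))
  simp only [Equiv.coe_addRight] at hu hv
  rw [hu, hv, Finset.sum_pi_single'] at hsum
  simp at hsum
  exact absurd hsum (by decide)

end Rank

/-- The points of Ledrappier's example that are fixed by `K`. -/
def planePoints (K : AddSubgroup (ℤ × ℤ)) : Submodule (ZMod 2) (ℤ × ℤ → ZMod 2) where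
  carrier := {y | (∀ a, y a + y (a + (1, 0)) + y (a + (0, 1)) = 0) ∧ ∀ v ∈ K, ∀ a, y (a + v) = y a}
  zero_mem' := by simp
  add_mem' := by
    rintro x y ⟨h₁, h₂⟩ ⟨h₃, h₄⟩
    refine ⟨fun a => ?_, fun v hv a => ?_⟩
    · simp only [Pi.add_apply]
      linear_combination h₁ a + h₃ a
    · simp only [Pi.add_apply, h₂ v hv, h₄ v hv]
  smul_mem' := by
    rintro c x ⟨h₁, h₂⟩
    refine ⟨fun a => ?_, fun v hv a => ?_⟩
    · simp only [Pi.smul_apply, smul_eq_mul]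
      linear_combination c * h₁ a
    · simp only [Pi.smul_apply, h₂ v hv]

/-- The number of points of Ledrappier's example that are fixed by `K`. -/
def planeCount (K : AddSubgroup (ℤ × ℤ)) : ℕ := Nat.card (planePoints K)

theorem planePoints_anti {K L : AddSubgroup (ℤ × ℤ)} (h : K ≤ L) :
    planePoints L ≤ planePoints K := fun _ hy => ⟨hy.1, fun v hv => hy.2 v (h hv)⟩

theorem planePoints_apply_eq_of_mk_eq {K : AddSubgroup (ℤ × ℤ)} {y : ℤ × ℤ → ZMod 2} (hy : y ∈ planePoints K)
    {a b : ℤ × ℤ} (h : (a : (ℤ × ℤ) ⧸ K) = b) : y a = y b := by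
  rw [QuotientAddGroup.eq] at h
  have := hy.2 _ h a
  rw [← this]
  congr 1
  abel

/-- Periodic points are functions on the quotient. -/
def toQuotient (K : AddSubgroup (ℤ × ℤ)) :
    planePoints K → LinearMap.ker (threeDot (((1, 0) : ℤ × ℤ) : (ℤ × ℤ) ⧸ K) ((0, 1) : ℤ × ℤ)) :=
  fun y => ⟨fun q => y.1 q.out, by
    rw [LinearMap.mem_ker]
    funext q
    rw [threeDot_apply, Pi.zero_apply, ← y.2.1 q.out]
    congr 1
    · congr 1
      apply planePoints_apply_eq_of_mk_eq y.2
      simp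
    · apply planePoints_apply_eq_of_mk_eq y.2
      simp⟩

theorem toQuotient_injective (K : AddSubgroup (ℤ × ℤ)) : Function.Injective (toQuotient K) := by
  intro y z h
  ext a
  have h₁ := congrFun (congrArg Subtype.val h) (a : (ℤ × ℤ) ⧸ K)
  change y.1 _ = z.1 _ at h₁
  have e : ∀ w ∈ planePoints K, w (Quotient.out (a : (ℤ × ℤ) ⧸ K)) = w a := fun w hw =>
    planePoints_apply_eq_of_mk_eq hw (by simp)
  rwa [e _ y.2, e _ z.2] at h₁

theorem finite_quotient {K : AddSubgroup (ℤ × ℤ)} (hK : K.index ≠ 0) : Finite ((ℤ × ℤ) ⧸ K) :=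
  have : K.FiniteIndex := ⟨hK⟩
  AddSubgroup.finite_quotient_of_finiteIndex

theorem finite_planePoints {K : AddSubgroup (ℤ × ℤ)} (hK : K.index ≠ 0) :
    Finite (planePoints K) := by
  have := finite_quotient hK
  exact Finite.of_injective _ (toQuotient_injective K)

theorem planeCount_pos {K : AddSubgroup (ℤ × ℤ)} (hK : K.index ≠ 0) : 0 < planeCount K := by
  have := finite_planePoints hK
  exact Nat.card_pos

theorem planeCount_mono {K L : AddSubgroup (ℤ × ℤ)} (hK : K.index ≠ 0) (h : K ≤ L) :
    planeCount L ≤ planeCount K := by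
  have := finite_planePoints hK
  exact Nat.card_le_card_of_injective _ (Submodule.inclusion_injective (planePoints_anti h))

theorem planeCount_pow_three_le {K : AddSubgroup (ℤ × ℤ)} (hK : K.index ≠ 0) :
    planeCount K ^ 3 ≤ 4 ^ K.index := by
  have := finite_quotient hK
  have h₁ := Nat.card_le_card_of_injective _ (toQuotient_injective K)
  have h₂ := three_mul_finrank_ker_threeDot_le (((1, 0) : ℤ × ℤ) : (ℤ × ℤ) ⧸ K) ((0, 1) : ℤ × ℤ)
  rw [Module.natCard_eq_pow_finrank (K := ZMod 2) (V := LinearMap.ker _), Nat.card_zmod] at h₁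
  change planeCount K ≤ _ at h₁
  calc planeCount K ^ 3 ≤ (2 ^ Module.finrank (ZMod 2) _) ^ 3 := Nat.pow_le_pow_left h₁ 3
    _ ≤ 2 ^ (2 * K.index) := by
      rw [← pow_mul]
      exact Nat.pow_le_pow_right two_pos (by rw [mul_comm]; exact h₂)
    _ = 4 ^ K.index := by rw [pow_mul]; norm_num

/-! ### Polynomial relations between shifts and the square-root bound -/

section Shift

open Polynomial

/-- The shift of functions on the plane by the vector `e`. -/
def planeShift (e : ℤ × ℤ) : Module.End (ZMod 2) (ℤ × ℤ → ZMod 2) :=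
  LinearMap.funLeft (ZMod 2) (ZMod 2) (· + e)

theorem planeShift_apply (e : ℤ × ℤ) (y : ℤ × ℤ → ZMod 2) (a : ℤ × ℤ) :
    planeShift e y a = y (a + e) := rfl

theorem planeShift_mul (e f : ℤ × ℤ) : planeShift e * planeShift f = planeShift (e + f) := by
  ext y a
  rw [Module.End.mul_apply, planeShift_apply, planeShift_apply, planeShift_apply, add_assoc]

theorem planeShift_pow (e : ℤ × ℤ) (n : ℕ) : planeShift e ^ n = planeShift (n • e) := by
  induction n with
  | zero =>
    ext y a
    simp [planeShift_apply]
  | succ n ih => rw [pow_succ, ih, planeShift_mul, succ_nsmul]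

/-- In characteristic 2 the three-dot relation makes the vertical shift a polynomial in the
horizontal one, so that `(i, j)` acts as `X^i (1 + X)^j`. -/
theorem planeShift_zero_one {K : AddSubgroup (ℤ × ℤ)} {y : ℤ × ℤ → ZMod 2}
    (hy : y ∈ planePoints K) : planeShift (0, 1) y = (1 + planeShift (1, 0)) y := by
  funext a
  have h : ∀ p q r : ZMod 2, p + q + r = 0 → r = p + q := by decide
  exact h _ _ _ (hy.1 a)

theorem planeShift_zero_one_pow {K : AddSubgroup (ℤ × ℤ)} {y : ℤ × ℤ → ZMod 2}
    (hy : y ∈ planePoints K) (j : ℕ) :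
    (planeShift (0, 1) ^ j) y = ((1 + planeShift (1, 0)) ^ j) y := by
  have hc : Commute (planeShift (0, 1)) (1 + planeShift (1, 0)) := by
    refine (Commute.one_right _).add_right ?_
    change _ * _ = _ * _
    rw [planeShift_mul, planeShift_mul, add_comm]
  induction j with
  | zero => rfl
  | succ j ih =>
    rw [pow_succ', Module.End.mul_apply, ih, ← Module.End.mul_apply, (hc.pow_right j).eq,
      Module.End.mul_apply, planeShift_zero_one hy, pow_succ, Module.End.mul_apply]

theorem aeval_planeShift_apply (p : (ZMod 2)[X]) (y : ℤ × ℤ → ZMod 2) (a : ℤ × ℤ) :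
    aeval (planeShift (1, 0)) p y a =
      ∑ k ∈ Finset.range (p.natDegree + 1), p.coeff k * y (a + ((k : ℤ), 0)) := by
  rw [aeval_eq_sum_range, LinearMap.sum_apply, Finset.sum_apply]
  refine Finset.sum_congr rfl fun k _ => ?_
  rw [LinearMap.smul_apply, Pi.smul_apply, planeShift_pow, planeShift_apply, smul_eq_mul]
  simp

/-- A point that satisfies a polynomial relation is determined by finitely many coordinates. -/
theorem eq_zero_of_aeval_planeShift {K : AddSubgroup (ℤ × ℤ)} (hK : K.index ≠ 0)
    {y : ℤ × ℤ → ZMod 2} (hy : y ∈ planePoints K) {p : (ZMod 2)[X]} (hp : p ≠ 0)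
    (h : aeval (planeShift (1, 0)) p y = 0) (h₀ : ∀ k < p.natDegree, y ((k : ℤ), 0) = 0) :
    y = 0 := by
  -- The leading coefficient is nonzero, so the relation is a recursion to the right along the row
  -- at height 0.
  have h₁ : ∀ n : ℕ, y ((n : ℤ), 0) = 0 := by
    intro n
    induction n using Nat.strong_induction_on with
    | _ n ih =>
      by_cases hn : n < p.natDegree
      · exact h₀ n hn
      obtain ⟨l, rfl⟩ := Nat.exists_eq_add_of_le (not_lt.1 hn)
      have h₂ := congrFun h ((l : ℤ), 0)
      rw [aeval_planeShift_apply, Finset.sum_range_succ, Finset.sum_eq_zero, zero_add] at h₂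
      · have h₃ : p.coeff p.natDegree ≠ 0 := leadingCoeff_ne_zero.2 hp
        have h₄ := (mul_eq_zero.1 h₂).resolve_left h₃
        rw [← h₄]
        congr 1
        ext <;> simp [add_comm]
      · intro k hk
        have h₅ := ih (l + k) (by have := Finset.mem_range.1 hk; omega)
        rw [Nat.cast_add] at h₅
        rw [Prod.mk_add_mk, add_zero, h₅, mul_zero]
  have h₂ : ∀ j n : ℕ, y ((n : ℤ), (j : ℤ)) = 0 := by
    intro j
    induction j with
    | zero => exact h₁
    | succ j ih =>
      intro n
      have h₃ := hy.1 ((n : ℤ), (j : ℤ))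
      have h₄ := ih (n + 1)
      rw [Nat.cast_add] at h₄
      rw [Prod.mk_add_mk, Prod.mk_add_mk, ih n, add_zero, add_zero] at h₃
      rw [Nat.cast_add]
      rw [Nat.cast_one] at h₄ ⊢
      rw [h₄, zero_add, zero_add] at h₃
      exact h₃
  funext a
  have hm : 0 < K.index := Nat.pos_of_ne_zero hK
  -- Adding this period moves `a` into the first quadrant, where `y` is already known to vanish.
  have h₃ : K.index • (|a.1|, |a.2|) ∈ K := K.nsmul_index_mem _
  rw [Pi.zero_apply, ← hy.2 _ h₃ a]
  have h₄ : ∀ b : ℤ, 0 ≤ b + K.index * |b| := by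
    intro b
    have h₅ : (1 : ℤ) ≤ K.index := by exact_mod_cast hm
    nlinarith [neg_abs_le b, abs_nonneg b]
  obtain ⟨n, hn⟩ := Int.eq_ofNat_of_zero_le (h₄ a.1)
  obtain ⟨j, hj⟩ := Int.eq_ofNat_of_zero_le (h₄ a.2)
  rw [← h₂ j n]
  congr 1
  ext <;> simp [hn, hj]

/-- The exponents are the multiplicities of the roots 0 and 1. -/
theorem X_pow_mul_ne {i j i' j' : ℕ} (h : (i, j) ≠ (i', j')) :
    (X ^ i * (1 + X) ^ j - X ^ i' * (1 + X) ^ j' : (ZMod 2)[X]) ≠ 0 := by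
  have e : (1 + X : (ZMod 2)[X]) = X - C 1 := by
    have : (-1 : (ZMod 2)[X]) = 1 := by
      rw [← C_1, ← C_neg]
      rfl
    rw [C_1, sub_eq_add_neg, this, add_comm]
  have e' : (X : (ZMod 2)[X]) = X - C 0 := by simp
  have hne : ∀ i j, (X ^ i * (1 + X) ^ j : (ZMod 2)[X]) ≠ 0 := by
    intro i j
    rw [e]
    exact mul_ne_zero (pow_ne_zero _ X_ne_zero) (pow_ne_zero _ (X_sub_C_ne_zero 1))
  have r₀ : ∀ i j, rootMultiplicity 0 (X ^ i * (1 + X) ^ j : (ZMod 2)[X]) = i := by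
    intro i j
    rw [rootMultiplicity_mul (hne i j)]
    have h₁ : rootMultiplicity 0 (X ^ i : (ZMod 2)[X]) = i := by
      conv_lhs => rw [e']
      exact rootMultiplicity_X_sub_C_pow 0 i
    rw [h₁, rootMultiplicity_eq_zero, add_zero]
    simp
  have r₁ : ∀ i j, rootMultiplicity 1 (X ^ i * (1 + X) ^ j : (ZMod 2)[X]) = j := by
    intro i j
    rw [rootMultiplicity_mul (hne i j), e, rootMultiplicity_X_sub_C_pow,
      rootMultiplicity_eq_zero, zero_add]
    simp
  intro h0
  rw [sub_eq_zero] at h0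
  refine h (Prod.ext ?_ ?_)
  · rw [← r₀ i j, h0, r₀]
  · rw [← r₁ i j, h0, r₁]

/-- Congruent vectors act alike on `K`-periodic points, so the difference of their polynomials, of
degree at most `2 s`, annihilates these points. Each is then determined by at most `2 s`
coordinates. -/
theorem planeCount_le_of_congruent {K : AddSubgroup (ℤ × ℤ)} (hK : K.index ≠ 0) {s : ℕ}
    {i j i' j' : ℕ} (hi : i ≤ s) (hj : j ≤ s) (hi' : i' ≤ s) (hj' : j' ≤ s)
    (h : (i, j) ≠ (i', j'))
    (hmem : ((((i : ℤ), (j : ℤ)) : ℤ × ℤ) : (ℤ × ℤ) ⧸ K) = (((i' : ℤ), (j' : ℤ)) : ℤ × ℤ)) :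
    planeCount K ≤ 2 ^ (2 * s) := by
  set p : (ZMod 2)[X] := X ^ i * (1 + X) ^ j - X ^ i' * (1 + X) ^ j' with hp
  have hp0 : p ≠ 0 := X_pow_mul_ne h
  have hdeg' : ∀ i j, i ≤ s → j ≤ s → (X ^ i * (1 + X) ^ j : (ZMod 2)[X]).natDegree ≤ 2 * s := by
    intro i j hi hj
    compute_degree
    omega
  have hdeg : p.natDegree ≤ 2 * s :=
    (natDegree_sub_le _ _).trans (max_le (hdeg' i j hi hj) (hdeg' i' j' hi' hj'))
  have key : ∀ y ∈ planePoints K, aeval (planeShift (1, 0)) p y = 0 := by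
    intro y hy
    have h₁ : ∀ i j : ℕ, aeval (planeShift (1, 0)) (X ^ i * (1 + X) ^ j : (ZMod 2)[X]) y =
        planeShift ((i : ℤ), (j : ℤ)) y := by
      intro i j
      rw [map_mul, map_pow, map_pow, map_add, map_one, aeval_X, Module.End.mul_apply,
        ← planeShift_zero_one_pow hy, ← Module.End.mul_apply, planeShift_pow, planeShift_pow,
        planeShift_mul]
      simp
    rw [hp, map_sub, LinearMap.sub_apply, h₁, h₁, sub_eq_zero]
    funext a
    rw [planeShift_apply, planeShift_apply]
    apply planePoints_apply_eq_of_mk_eq hy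
    rw [QuotientAddGroup.mk_add, QuotientAddGroup.mk_add, hmem]
  let ρ : planePoints K → (Fin p.natDegree → ZMod 2) := fun y k => y.1 ((k : ℤ), 0)
  have hρ : Function.Injective ρ := by
    intro y z hyz
    have h₁ := (y - z).2
    have h₂ := eq_zero_of_aeval_planeShift hK h₁ hp0 (key _ h₁) (fun k hk => by
      have := congrFun hyz ⟨k, hk⟩
      exact sub_eq_zero.2 this)
    exact sub_eq_zero.1 (Subtype.ext h₂)
  have hcard := Nat.card_le_card_of_injective ρ hρ
  rw [Nat.card_fun, Nat.card_zmod, Nat.card_fin] at hcard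
  exact hcard.trans (Nat.pow_le_pow_right two_pos hdeg)

end Shift

/-- The number of periodic points grows at most like the exponential of the square root of the
index. -/
theorem planeCount_le_sqrt {K : AddSubgroup (ℤ × ℤ)} (hK : K.index ≠ 0) :
    planeCount K ≤ 2 ^ (2 * Nat.sqrt K.index) := by
  classical
  have := finite_quotient hK
  have := Fintype.ofFinite ((ℤ × ℤ) ⧸ K)
  set s := Nat.sqrt K.index
  let B : Finset (ℕ × ℕ) := Finset.range (s + 1) ×ˢ Finset.range (s + 1)
  -- Pigeonhole: there are `(s + 1)^2 > [K]` exponents `(i, j)` with `i, j ≤ s`.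
  have hB : (Finset.univ : Finset ((ℤ × ℤ) ⧸ K)).card < B.card := by
    rw [Finset.card_univ, ← Nat.card_eq_fintype_card, Finset.card_product, Finset.card_range]
    exact Nat.lt_succ_sqrt K.index
  obtain ⟨x, hx, x', hx', hne, heq⟩ := Finset.exists_ne_map_eq_of_card_lt_of_maps_to hB
    (f := fun x : ℕ × ℕ => ((((x.1 : ℤ), (x.2 : ℤ)) : ℤ × ℤ) : (ℤ × ℤ) ⧸ K))
    (fun _ _ => Finset.mem_coe.2 (Finset.mem_univ _))
  simp only [B, Finset.mem_product, Finset.mem_range, Nat.lt_succ_iff] at hx hx'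
  exact planeCount_le_of_congruent hK hx.1 hx.2 hx'.1 hx'.2 hne heq

/-! ### Subgroups with many periodic points -/

/-- The homomorphism `(a, b) ↦ a - b` to `ℤ / 3`. -/
def modThree : ℤ × ℤ →+ ZMod 3 :=
  (Int.castAddHom (ZMod 3)).comp (AddMonoidHom.fst ℤ ℤ - AddMonoidHom.snd ℤ ℤ)

theorem modThree_apply (a : ℤ × ℤ) : modThree a = ((a.1 - a.2 : ℤ) : ZMod 3) := rfl

theorem index_ker_modThree : modThree.ker.index = 3 := by
  have : Function.Surjective modThree := by
    intro k
    refine ⟨((k.val : ℤ), 0), ?_⟩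
    rw [modThree_apply]
    simp
  rw [AddSubgroup.index_ker, AddMonoidHom.range_eq_top_of_surjective _ this]
  simp

/-- The cube bound gives `F^3 ≤ 4^3`. Conversely, `(1, 0)` and `(0, 1)` map to 1 and 2 in `ℤ / 3`,
so the three-dot relation for functions of `a - b` is the single condition `f 0 + f 1 + f 2 = 0`,
with four solutions. -/
theorem planeCount_ker_modThree : planeCount modThree.ker = 4 := by
  have h0 : modThree.ker.index ≠ 0 := by
    rw [index_ker_modThree]
    norm_num
  have := finite_planePoints h0
  apply le_antisymm
  · have h := planeCount_pow_three_le h0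
    rw [index_ker_modThree] at h
    exact le_of_pow_le_pow_left₀ (by norm_num) (by norm_num) h
  · let F := {f : ZMod 3 → ZMod 2 // f 0 + f 1 + f 2 = 0}
    have hF : Nat.card F = 4 := by
      rw [Nat.card_eq_fintype_card]
      decide
    have hf : ∀ f : F, ∀ k : ZMod 3, f.1 k + f.1 (k + 1) + f.1 (k + 2) = 0 := by decide
    have e₁ : modThree (1, 0) = 1 := by simp [modThree_apply]
    have e₂ : modThree (0, 1) = 2 := by
      rw [modThree_apply]
      rfl
    let ι : F → planePoints modThree.ker := fun f =>
      ⟨fun a => f.1 (modThree a), fun a => by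
        beta_reduce
        rw [map_add, map_add, e₁, e₂]
        exact hf f _, fun v hv a => by
        beta_reduce
        rw [map_add, AddMonoidHom.mem_ker.1 hv, add_zero]⟩
    rw [← hF]
    refine Nat.card_le_card_of_injective ι fun f g h => ?_
    ext k
    have := congrFun (congrArg Subtype.val h) ((k.val : ℤ), 0)
    change f.1 (modThree _) = g.1 (modThree _) at this
    have e : modThree ((k.val : ℤ), 0) = k := by
      rw [modThree_apply]
      simp
    rwa [e] at this

/-- There are subgroups of arbitrarily large index with at least four periodic points. -/
theorem exists_four_le_planeCount (n : ℕ) :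
    ∃ K : AddSubgroup (ℤ × ℤ), n < K.index ∧ 4 ≤ planeCount K := by
  let Z := AddSubgroup.zmultiples ((3 * (n + 1) : ℕ) : ℤ)
  have hidx : (Z.prod Z).index = (3 * (n + 1)) * (3 * (n + 1)) := by
    rw [AddSubgroup.index_prod, Int.index_zmultiples, Int.natAbs_natCast]
  refine ⟨Z.prod Z, by rw [hidx]; nlinarith, ?_⟩
  rw [← planeCount_ker_modThree]
  refine planeCount_mono (by rw [hidx]; positivity) ?_
  rintro ⟨a, b⟩ ⟨ha, hb⟩
  have h₁ := Int.mem_zmultiples_iff.1 ha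
  have h₂ := Int.mem_zmultiples_iff.1 hb
  rw [AddMonoidHom.mem_ker, modThree_apply, ZMod.intCast_zmod_eq_zero_iff_dvd]
  have h₃ : ((3 : ℕ) : ℤ) ∣ ((3 * (n + 1) : ℕ) : ℤ) := Int.natCast_dvd_natCast.2 ⟨n + 1, rfl⟩
  exact dvd_sub (h₃.trans h₁) (h₃.trans h₂)

/-! ### Periodic points of the shift extension -/

/-- The group `ℤ^3` as a product. -/
def spaceEquiv : (Fin 3 → ℤ) ≃+ (ℤ × ℤ) × ℤ where
  toFun n := ((n 0, n 1), n 2)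
  invFun p := ![p.1.1, p.1.2, p.2]
  left_inv n := by
    ext i
    fin_cases i <;> rfl
  right_inv _ := rfl
  map_add' _ _ := rfl

theorem spaceEquiv_symm_apply (p : (ℤ × ℤ) × ℤ) :
    spaceEquiv.symm p = ![p.1.1, p.1.2, p.2] := rfl

/-- The points of the shift extension that are fixed by `Λ`, as functions on `(ℤ × ℤ) × ℤ`. -/
def spacePoints (Λ : AddSubgroup ((ℤ × ℤ) × ℤ)) : Set ((ℤ × ℤ) × ℤ → ZMod 2) :=
  {x | (∀ a k, x (a, k) + x (a + (1, 0), k) + x (a + (0, 1), k) = 0) ∧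
    ∀ v ∈ Λ, ∀ p, x (p + v) = x p}

theorem ledrappierExt_apply_symm (x : ledrappierExt) (a : ℤ × ℤ) (k : ℤ) :
    x.1 (spaceEquiv.symm (a, k)) + x.1 (spaceEquiv.symm (a + (1, 0), k)) +
      x.1 (spaceEquiv.symm (a + (0, 1), k)) = 0 := by
  have h := x.2 a.1 a.2 k
  simpa [spaceEquiv_symm_apply] using h

/-- The two descriptions of the periodic points of the shift extension. -/
def fixedPointsEquiv (Λ : AddSubgroup ((ℤ × ℤ) × ℤ)) :
    AddAction.fixedPoints (Λ.comap (spaceEquiv : (Fin 3 → ℤ) →+ (ℤ × ℤ) × ℤ)) ledrappierExt ≃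
      spacePoints Λ where
  toFun x := ⟨fun p => x.1.1 (spaceEquiv.symm p), ledrappierExt_apply_symm x.1, fun v hv p => by
    have h := x.2 ⟨spaceEquiv.symm v, by simpa using hv⟩
    have h' := congrFun (congrArg Subtype.val h) (spaceEquiv.symm p)
    beta_reduce
    rw [map_add]
    exact h'⟩
  invFun y := ⟨⟨fun n => y.1 (spaceEquiv n), fun i j k => by
    have h := y.2.1 (i, j) k
    simp only [Prod.mk_add_mk, add_zero] at h
    exact h⟩, fun v => Subtype.ext (funext fun n => by
      have h := y.2.2 (spaceEquiv v.1) v.2 (spaceEquiv n)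
      rw [← map_add] at h
      exact h)⟩
  left_inv x := by
    apply Subtype.ext
    apply Subtype.ext
    funext n
    change x.1.1 (spaceEquiv.symm (spaceEquiv n)) = _
    rw [AddEquiv.symm_apply_apply]
  right_inv _ := rfl

/-- A periodic point consists of `c` horizontal layers, which can be chosen independently. -/
def layersEquiv (K : AddSubgroup (ℤ × ℤ)) (c : ℕ) (hc : 0 < c) (t : (ℤ × ℤ) ⧸ K) :
    spacePoints (tower K c t) ≃ (Fin c → planePoints K) where
  toFun x s := ⟨fun a => x.1 (a, ((s : ℕ) : ℤ)), fun a => x.2.1 a _, fun v hv a => by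
    have h := x.2.2 (v, 0) ((mem_tower_zero hc).2 hv) (a, ((s : ℕ) : ℤ))
    rwa [Prod.mk_add_mk, add_zero] at h⟩
  -- Translating by a multiple of the period `(t.out, c)` brings the height into `[0, c)`. The
  -- choice of representative `t.out` does not matter, since each layer is `K`-periodic.
  invFun y := ⟨fun p => (y ⟨(p.2 % c).toNat, by
      have := Int.emod_nonneg p.2 (Int.natCast_ne_zero.2 hc.ne')
      have := Int.emod_lt_of_pos p.2 (Int.natCast_pos.2 hc)
      omega⟩).1 (p.1 - (p.2 / c) • t.out), fun a k => by
    have h := (y ⟨(k % c).toNat, by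
      have := Int.emod_nonneg k (Int.natCast_ne_zero.2 hc.ne')
      have := Int.emod_lt_of_pos k (Int.natCast_pos.2 hc)
      omega⟩).2.1 (a - (k / c) • t.out)
    rw [sub_add_eq_add_sub, sub_add_eq_add_sub] at h
    exact h, by
    rintro ⟨b, l⟩ ⟨q, h₁, h₂⟩ ⟨a, k⟩
    dsimp only at h₁ h₂
    subst h₁
    have hc' : (c : ℤ) ≠ 0 := Int.natCast_ne_zero.2 hc.ne'
    simp only [Prod.mk_add_mk, Int.add_mul_emod_self_right, Int.add_mul_ediv_right _ _ hc']
    apply planePoints_apply_eq_of_mk_eq (Subtype.property _)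
    rw [QuotientAddGroup.mk_sub, QuotientAddGroup.mk_sub, QuotientAddGroup.mk_add,
      QuotientAddGroup.mk_zsmul, QuotientAddGroup.mk_zsmul, QuotientAddGroup.out_eq', h₂, add_zsmul]
    abel⟩
  left_inv x := by
    apply Subtype.ext
    funext ⟨a, k⟩
    have h₀ := Int.emod_nonneg k (Int.natCast_ne_zero.2 hc.ne')
    have h := x.2.2 ((k / c) • t.out, (k / c) * c) ⟨k / c, rfl, by
      rw [QuotientAddGroup.mk_zsmul, QuotientAddGroup.out_eq']⟩ (a - (k / c) • t.out, k % c)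
    change x.1 (a - (k / c) • t.out, ((k % c).toNat : ℤ)) = _
    rw [Int.toNat_of_nonneg h₀, ← h, Prod.mk_add_mk, sub_add_cancel, mul_comm, Int.emod_add_mul_ediv]
  right_inv y := by
    funext s
    apply Subtype.ext
    funext a
    have h₁ : ((s : ℕ) : ℤ) % c = (s : ℕ) :=
      Int.emod_eq_of_lt (by positivity) (by exact_mod_cast s.isLt)
    have h₂ : ((s : ℕ) : ℤ) / c = 0 :=
      Int.ediv_eq_zero_of_lt (by positivity) (by exact_mod_cast s.isLt)
    simp only [h₁, h₂, Int.toNat_natCast, zero_smul, sub_zero]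

/-- Subgroups of finite index of `ℤ^3`, given by their data. -/
def latticeEquiv : TowerData (ℤ × ℤ) ≃ FinIdx (Fin 3 → ℤ) :=
  (towerEquiv (ℤ × ℤ)).trans
    { toFun := fun Λ => ⟨Λ.1.comap (spaceEquiv : (Fin 3 → ℤ) →+ (ℤ × ℤ) × ℤ), by
        rw [AddSubgroup.index_comap_of_surjective _ spaceEquiv.surjective]
        exact Λ.2⟩
      invFun := fun Λ => ⟨Λ.1.comap (spaceEquiv.symm : (ℤ × ℤ) × ℤ →+ (Fin 3 → ℤ)), by
        rw [AddSubgroup.index_comap_of_surjective _ spaceEquiv.symm.surjective]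
        exact Λ.2⟩
      left_inv := fun Λ => by
        apply Subtype.ext
        ext p
        simp
      right_inv := fun Λ => by
        apply Subtype.ext
        ext p
        simp }

theorem index_latticeEquiv (x : TowerData (ℤ × ℤ)) :
    (latticeEquiv x).1.index = x.1.1.index * (x.2.1 + 1) :=
  (AddSubgroup.index_comap_of_surjective _ spaceEquiv.surjective).trans (index_ofTowerData x)

/-- The periodic points of a lattice, in layers. -/
def fixedPointsLatticeEquiv (x : TowerData (ℤ × ℤ)) :
    AddAction.fixedPoints (latticeEquiv x).1 ledrappierExt ≃
      (Fin (x.2.1 + 1) → planePoints x.1.1) :=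
  (fixedPointsEquiv _).trans (layersEquiv x.1.1 (x.2.1 + 1) x.2.1.succ_pos x.2.2)

theorem periodicCount_latticeEquiv (x : TowerData (ℤ × ℤ)) :
    periodicCount 3 ledrappierExt (latticeEquiv x).1 = planeCount x.1.1 ^ (x.2.1 + 1) := by
  rw [periodicCount, Nat.card_congr (fixedPointsLatticeEquiv x), Nat.card_fun, Nat.card_fin,
    planeCount]

theorem finite_fixedPoints (Λ : AddSubgroup (Fin 3 → ℤ)) (hΛ : Λ.index ≠ 0) :
    (AddAction.fixedPoints Λ ledrappierExt).Finite := by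
  obtain ⟨x, hx⟩ := latticeEquiv.surjective ⟨Λ, hΛ⟩
  have h := fixedPointsLatticeEquiv x
  rw [hx] at h
  have := finite_planePoints x.1.2
  have := Finite.of_equiv _ h.symm
  exact Set.toFinite _

theorem periodicCount_pow_three_le (Λ : FinIdx (Fin 3 → ℤ)) :
    periodicCount 3 ledrappierExt Λ.1 ^ 3 ≤ 4 ^ Λ.1.index := by
  obtain ⟨x, rfl⟩ := latticeEquiv.surjective Λ
  rw [periodicCount_latticeEquiv, index_latticeEquiv, ← pow_mul, mul_comm _ 3, pow_mul,
    pow_mul 4]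
  exact Nat.pow_le_pow_left (planeCount_pow_three_le x.1.2) _

theorem periodicCount_pos (Λ : FinIdx (Fin 3 → ℤ)) : 0 < periodicCount 3 ledrappierExt Λ.1 := by
  obtain ⟨x, rfl⟩ := latticeEquiv.surjective Λ
  rw [periodicCount_latticeEquiv]
  exact pow_pos (planeCount_pos x.1.2) _

/-! ### The growth rate of periodic points -/

theorem log_div_natCast (F m : ℕ) (hF : 0 < F) :
    ENNReal.log (F : ℝ≥0∞) / ((m : ℕ) : EReal) = ((Real.log F / m : ℝ) : EReal) := by
  have : (F : ℝ≥0∞) = ENNReal.ofReal (F : ℝ) := by simp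
  rw [this, ENNReal.log_ofReal_of_pos (by exact_mod_cast hF), EReal.coe_div]
  rfl

theorem upperGrowthRate_eq :
    upperGrowthRate 3 ledrappierExt = ((2 / 3 * Real.log 2 : ℝ) : EReal) := by
  have hidx : ∀ Λ : {Λ : AddSubgroup (Fin 3 → ℤ) // Λ.FiniteIndex}, Λ.1.index ≠ 0 :=
    fun Λ => Λ.2.index_ne_zero
  rw [upperGrowthRate]
  have hlog : Real.log 4 = 2 * Real.log 2 := by
    rw [show (4 : ℝ) = 2 ^ 2 by norm_num, Real.log_pow]
    norm_num
  apply le_antisymm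
  · refine limsup_le_of_le (by isBoundedDefault) (Eventually.of_forall fun Λ => ?_)
    rw [log_div_natCast _ _ (periodicCount_pos ⟨Λ.1, hidx Λ⟩), EReal.coe_le_coe_iff]
    have hm : (0 : ℝ) < Λ.1.index := by exact_mod_cast Nat.pos_of_ne_zero (hidx Λ)
    have hF : (0 : ℝ) < periodicCount 3 ledrappierExt Λ.1 := by
      exact_mod_cast periodicCount_pos ⟨Λ.1, hidx Λ⟩
    have h : ((periodicCount 3 ledrappierExt Λ.1 : ℝ)) ^ 3 ≤ 4 ^ Λ.1.index := by
      exact_mod_cast periodicCount_pow_three_le ⟨Λ.1, hidx Λ⟩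
    have h' := Real.log_le_log (by positivity) h
    rw [Real.log_pow, Real.log_pow, hlog] at h'
    rw [div_le_iff₀ hm]
    push_cast at h'
    linarith
  · refine le_limsup_of_frequently_le ?_ (by isBoundedDefault)
    rw [Filter.frequently_comap]
    rw [frequently_atTop]
    intro N
    -- Over this extremal `K`, the height `N + 1` gives `4^(N + 1)` points at index `3 (N + 1)`,
    -- which attains the bound exactly.
    let x : TowerData (ℤ × ℤ) := ⟨⟨modThree.ker, by rw [index_ker_modThree]; norm_num⟩, N, 0⟩
    have hi : (latticeEquiv x).1.index = 3 * (N + 1) := by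
      rw [index_latticeEquiv, index_ker_modThree]
    refine ⟨_, ?_, ⟨(latticeEquiv x).1, ⟨(latticeEquiv x).2⟩⟩, rfl, ?_⟩
    · dsimp only
      rw [hi]
      omega
    · dsimp only
      rw [log_div_natCast _ _ (periodicCount_pos _), periodicCount_latticeEquiv, hi,
        EReal.coe_le_coe_iff, planeCount_ker_modThree]
      apply le_of_eq
      push_cast
      rw [Real.log_pow, hlog]
      push_cast
      change _ = ((N : ℝ) + 1) * _ / _
      have : (N : ℝ) + 1 ≠ 0 := by positivity
      field_simp

/-! ### Entropy -/

/-- The points that agree with `x` on `I`. -/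
def cylinder (I : Finset (Fin 3 → ℤ)) (x : ledrappierExt) : Set ledrappierExt :=
  {z | ∀ i ∈ I, z.1 i = x.1 i}

theorem cylinder_mem_nhds (I : Finset (Fin 3 → ℤ)) (x : ledrappierExt) : cylinder I x ∈ 𝓝 x := by
  refine (eventually_all_finset I).2 fun i _ => ?_
  have hc : ContinuousAt (fun z : ledrappierExt => z.1 i) x :=
    ((continuous_apply i).comp continuous_subtype_val).continuousAt
  exact hc (isOpen_discrete {x.1 i} |>.mem_nhds rfl)

theorem exists_cylinder_subset {U : Set ledrappierExt} (hU : IsOpen U) {x : ledrappierExt}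
    (hx : x ∈ U) : ∃ I, cylinder I x ⊆ U := by
  obtain ⟨O, hO, rfl⟩ := isOpen_induced_iff.1 hU
  obtain ⟨I, u, hu, hsub⟩ := isOpen_pi_iff.1 hO x.1 hx
  refine ⟨I, fun z hz => hsub fun i hi => ?_⟩
  rw [hz i hi]
  exact (hu i hi).2

/-- Every open cover is refined by the cylinders over a finite set. -/
theorem exists_cylinder_refines {𝒰 : Set (Set ledrappierExt)} (ho : ∀ U ∈ 𝒰, IsOpen U)
    (hc : ⋃₀ 𝒰 = univ) : ∃ I, ∀ x, ∃ U ∈ 𝒰, cylinder I x ⊆ U := by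
  classical
  have h₁ : ∀ x : ledrappierExt, ∃ U ∈ 𝒰, x ∈ U := fun x => mem_sUnion.1 (hc ▸ mem_univ x)
  choose U hU hxU using h₁
  choose J hJ using fun x => exists_cylinder_subset (ho _ (hU x)) (hxU x)
  obtain ⟨s, -, hs⟩ := isCompact_univ.elim_nhds_subcover (fun x => cylinder (J x) x)
    fun x _ => cylinder_mem_nhds (J x) x
  -- A cylinder around `x` over the union of the finitely many windows lies in the cylinder of some
  -- centre `y` whose cylinder contains `x`.
  refine ⟨s.biUnion J, fun x => ?_⟩
  obtain ⟨y, hy, hxy⟩ := mem_iUnion₂.1 (hs (mem_univ x))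
  refine ⟨U y, hU y, fun z hz => hJ y fun i hi => ?_⟩
  rw [hz i (Finset.mem_biUnion.2 ⟨y, hy, hi⟩), hxy i hi]

/-- The coordinates on the side of a box that determine those in the box. -/
def boxPattern (k N : ℕ) (x : ledrappierExt) : Fin (2 * N) × Fin N → ZMod 2 :=
  fun p => x.1 ![(p.1 : ℤ) - k, -k, (p.2 : ℤ) - k]

/-- Each step upwards shortens the determined part of a row by one cell; a base of length `2 N` thus
still determines `N` cells in each of the `N` lowest rows. -/
theorem eq_of_boxPattern_eq {k N : ℕ} {x y : ledrappierExt}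
    (h : boxPattern k N x = boxPattern k N y) (j : ℕ) :
    ∀ s l : ℕ, s + j < 2 * N → l < N →
      x.1 ![(s : ℤ) - k, (j : ℤ) - k, (l : ℤ) - k] = y.1 ![(s : ℤ) - k, (j : ℤ) - k, (l : ℤ) - k] := by
  have e : ∀ p q r : ZMod 2, p + q + r = 0 → r = p + q := by decide
  have e' : ∀ (z : ledrappierExt) (a b c : ℤ), z.1 ![a, b + 1, c] = z.1 ![a, b, c] +
    z.1 ![a + 1, b, c] := fun z a b c => e _ _ _ (z.2 a b c)
  induction j with
  | zero =>
    intro s l hs hl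
    have := congrFun h (⟨s, hs⟩, ⟨l, hl⟩)
    simpa [boxPattern] using this
  | succ j ih =>
    intro s l hs hl
    have h₁ := ih s l (by omega) hl
    have h₂ := ih (s + 1) l (by omega) hl
    have e₁ : ((j + 1 : ℕ) : ℤ) - k = (j : ℤ) - k + 1 := by push_cast; ring
    have e₂ : ((s + 1 : ℕ) : ℤ) - k = (s : ℤ) - k + 1 := by push_cast; ring
    rw [e₂] at h₂
    rw [e₁, e', e', h₁, h₂]

theorem minSubcover_refinement_le {𝒰 : Set (Set ledrappierExt)} {k : ℕ}
    (hk : ∀ x : ledrappierExt, ∃ U ∈ 𝒰,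
      ∀ z : ledrappierExt, (∀ i : Fin 3 → ℤ, (∀ r, |i r| ≤ (k : ℤ)) → z.1 i = x.1 i) → z ∈ U) (n : ℕ) :
    minSubcover (refinement 𝒰 (box 3 n)) ≤
      ((2 ^ (2 * (n + 2 * k + 1) * (n + 2 * k + 1)) : ℕ) : ℕ∞) := by
  choose U hU hsub using hk
  set N := n + 2 * k + 1 with hN
  -- One member of the refinement for each pattern, built from a point with that pattern; for
  -- patterns that do not occur, `invFun` supplies an arbitrary point. The side `N` suffices for the
  -- `n`-box widened by `k` on both sides.
  let V : (Fin (2 * N) × Fin N → ZMod 2) → Set ledrappierExt := fun p =>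
    ⋂ m ∈ box 3 n, (fun x => m +ᵥ x) ⁻¹' U (m +ᵥ Function.invFun (boxPattern k N) p)
  have hV : ∀ x, x ∈ V (boxPattern k N x) := by
    intro x
    refine mem_iInter₂.2 fun m hm => hsub _ _ fun i hi => ?_
    have h : boxPattern k N (Function.invFun (boxPattern k N) (boxPattern k N x)) =
      boxPattern k N x := Function.invFun_eq ⟨x, rfl⟩
    change x.1 (i + m) = (Function.invFun (boxPattern k N) (boxPattern k N x)).1 (i + m)
    have hm' := fun r => Finset.mem_Ico.1 (Fintype.mem_piFinset.1 hm r)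
    have hr : ∀ r, ∃ s : ℕ, (i + m) r = s - k ∧ s < N := by
      intro r
      have h₁ := abs_le.1 (hi r)
      have h₂ := hm' r
      refine ⟨(i r + m r + k).toNat, ?_, by omega⟩
      rw [Int.toNat_of_nonneg (by omega), Pi.add_apply]
      ring
    choose s hs hsN using hr
    have him : i + m = ![(s 0 : ℤ) - k, (s 1 : ℤ) - k, (s 2 : ℤ) - k] := by
      ext r
      fin_cases r
      · exact hs 0
      · exact hs 1
      · exact hs 2
    rw [him]
    have h₀ := hsN 0
    have h₁ := hsN 1
    exact (eq_of_boxPattern_eq h (s 1) (s 0) (s 2) (by omega) (hsN 2)).symm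
  have hmem : V '' univ ∈ {s : Set (Set ledrappierExt) |
      s ⊆ refinement 𝒰 (box 3 n) ∧ ⋃₀ s = univ} := by
    refine ⟨?_, eq_univ_of_forall fun x => mem_sUnion.2 ⟨_, ⟨_, mem_univ _, rfl⟩, hV x⟩⟩
    rintro _ ⟨p, -, rfl⟩
    exact ⟨fun m => U (m +ᵥ Function.invFun (boxPattern k N) p), fun m _ => hU _, rfl⟩
  refine (iInf₂_le _ hmem).trans ((encard_image_le _ _).trans ?_)
  rw [encard_univ, ENat.card_eq_coe_fintype_card]
  simp

theorem card_box (d n : ℕ) : (box d n).card = n ^ d := by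
  simp [box]

theorem topologicalEntropy_eq_zero : topologicalEntropy 3 ledrappierExt = 0 := by
  apply le_antisymm
  · refine iSup₂_le fun 𝒰 h𝒰 => ?_
    obtain ⟨I, hI⟩ := exists_cylinder_refines h𝒰.1 h𝒰.2
    let k : ℕ := I.sup fun i => Finset.univ.sup fun r => (i r).natAbs
    have hk : ∀ x : ledrappierExt, ∃ U ∈ 𝒰,
        ∀ z : ledrappierExt, (∀ i : Fin 3 → ℤ, (∀ r, |i r| ≤ (k : ℤ)) → z.1 i = x.1 i) → z ∈ U := by
      intro x
      obtain ⟨U, hU, hsub⟩ := hI x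
      refine ⟨U, hU, fun z hz => hsub fun i hi => hz i fun r => ?_⟩
      have h₁ : (i r).natAbs ≤ Finset.univ.sup fun r => (i r).natAbs :=
        Finset.le_sup (f := fun r => (i r).natAbs) (Finset.mem_univ r)
      have h₂ : (Finset.univ.sup fun r => (i r).natAbs) ≤ k :=
        Finset.le_sup (f := fun i => Finset.univ.sup fun r => (i r).natAbs) hi
      rw [Int.abs_eq_natAbs]
      exact_mod_cast h₁.trans h₂
    -- For `n ≥ 1`, `n + 2 k + 1 ≤ (2 k + 2) n`, so the exponent `2 (n + 2 k + 1)^2` divided by the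
    -- volume `n^3` is `O(1 / n)`.
    let C : ℝ := 2 * (2 * k + 2) ^ 2 * Real.log 2
    have hlim : Tendsto (fun n : ℕ => ((C / n : ℝ) : EReal)) atTop (𝓝 ((0 : ℝ) : EReal)) :=
      (continuous_coe_real_ereal.tendsto 0).comp (tendsto_const_div_atTop_nhds_zero_nat C)
    rw [EReal.coe_zero] at hlim
    rw [← hlim.limsup_eq]
    refine limsup_le_limsup ?_ (by isBoundedDefault) (by isBoundedDefault)
    filter_upwards [eventually_ge_atTop 1] with n hn
    have h₁ : (minSubcover (refinement 𝒰 (box 3 n)) : ℝ≥0∞) ≤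
        ((2 ^ (2 * (n + 2 * k + 1) * (n + 2 * k + 1)) : ℕ) : ℝ≥0∞) := by
      have := ENat.toENNReal_le.2 (minSubcover_refinement_le hk n)
      exact this.trans_eq (ENat.toENNReal_coe _)
    refine (EReal.div_le_div_right_of_nonneg (by positivity) (ENNReal.log_monotone h₁)).trans ?_
    rw [log_div_natCast _ _ (by positivity), EReal.coe_le_coe_iff, card_box]
    have hn' : (1 : ℝ) ≤ n := by exact_mod_cast hn
    have h2 : 0 < Real.log 2 := Real.log_pos one_lt_two
    push_cast
    rw [Real.log_pow, div_le_div_iff₀ (by positivity) (by positivity)]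
    have h₃ : (n : ℝ) + 2 * k + 1 ≤ (2 * k + 2) * n := by
      nlinarith [(Nat.cast_nonneg k : (0 : ℝ) ≤ k)]
    have h₄ : ((n : ℝ) + 2 * k + 1) ^ 2 ≤ ((2 * k + 2) * n) ^ 2 :=
      pow_le_pow_left₀ (by positivity) h₃ 2
    have h₅ := mul_le_mul_of_nonneg_right h₄ (by positivity : 0 ≤ 2 * Real.log 2 * n)
    push_cast
    simp only [C]
    nlinarith
  · have hmem : ({univ} : Set (Set ledrappierExt)) ∈
        {𝒰 : Set (Set ledrappierExt) | (∀ U ∈ 𝒰, IsOpen U) ∧ ⋃₀ 𝒰 = univ} := by simp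
    refine le_trans ?_ (le_iSup₂ (α := EReal) {univ} hmem)
    refine le_limsup_of_frequently_le (Frequently.of_forall fun n => ?_) (by isBoundedDefault)
    refine EReal.div_nonneg ?_ (by positivity)
    rw [← ENNReal.log_one]
    refine ENNReal.log_monotone ?_
    have : (1 : ℕ∞) ≤ minSubcover (refinement ({univ} : Set (Set ledrappierExt)) (box 3 n)) := by
      refine le_iInf₂ fun s (hs : s ⊆ refinement _ _ ∧ ⋃₀ s = univ) => ?_
      rw [one_le_encard_iff_nonempty, nonempty_iff_ne_empty]
      rintro rfl
      have := hs.2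
      rw [sUnion_empty] at this
      exact empty_ne_univ this
    exact_mod_cast ENat.toENNReal_le.2 this

/-! ### The exponential of a power series -/

section Exp

variable {A : PowerSeries ℂ} {z : ℂ}

theorem coeff_pow_succ_mul (k n : ℕ) :
    PowerSeries.coeff n (A ^ (k + 1)) * z ^ n = ∑ p ∈ Finset.HasAntidiagonal.antidiagonal n,
      (PowerSeries.coeff p.1 (A ^ k) * z ^ p.1) * (PowerSeries.coeff p.2 A * z ^ p.2) := by
  rw [pow_succ, PowerSeries.coeff_mul, Finset.sum_mul]
  refine Finset.sum_congr rfl fun p hp => ?_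
  rw [← Finset.HasAntidiagonal.mem_antidiagonal.1 hp, pow_add]
  ring

theorem summable_norm_coeff_pow (hs : Summable fun n => ‖PowerSeries.coeff n A * z ^ n‖) (k : ℕ) :
    Summable fun n => ‖PowerSeries.coeff n (A ^ k) * z ^ n‖ := by
  induction k with
  | zero =>
    refine summable_of_ne_finset_zero (s := {0}) fun n hn => ?_
    rw [pow_zero, PowerSeries.coeff_one, if_neg (by simpa using hn), zero_mul, norm_zero]
  | succ k ih =>
    simp only [coeff_pow_succ_mul]
    exact summable_norm_sum_mul_antidiagonal_of_summable_norm
      (f := fun n => PowerSeries.coeff n (A ^ k) * z ^ n)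
      (g := fun n => PowerSeries.coeff n A * z ^ n) ih hs

theorem tsum_coeff_pow (hs : Summable fun n => ‖PowerSeries.coeff n A * z ^ n‖) (k : ℕ) :
    ∑' n, PowerSeries.coeff n (A ^ k) * z ^ n = (∑' n, PowerSeries.coeff n A * z ^ n) ^ k := by
  induction k with
  | zero =>
    rw [tsum_eq_single 0]
    · simp
    · intro n hn
      rw [pow_zero, PowerSeries.coeff_one, if_neg hn, zero_mul]
  | succ k ih =>
    simp only [coeff_pow_succ_mul]
    rw [← tsum_mul_tsum_eq_tsum_sum_antidiagonal_of_summable_norm (summable_norm_coeff_pow hs k) hs,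
      ih, pow_succ]

theorem tsum_norm_coeff_pow_le (hs : Summable fun n => ‖PowerSeries.coeff n A * z ^ n‖) (k : ℕ) :
    ∑' n, ‖PowerSeries.coeff n (A ^ k) * z ^ n‖ ≤
      (∑' n, ‖PowerSeries.coeff n A * z ^ n‖) ^ k := by
  induction k with
  | zero =>
    rw [tsum_eq_single 0]
    · simp
    · intro n hn
      rw [pow_zero, PowerSeries.coeff_one, if_neg hn, zero_mul, norm_zero]
  | succ k ih =>
    have hk := summable_norm_coeff_pow hs k
    have h₁ : Summable fun n => ‖(‖PowerSeries.coeff n (A ^ k) * z ^ n‖)‖ := by simpa using hk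
    have h₂ : Summable fun n => ‖(‖PowerSeries.coeff n A * z ^ n‖)‖ := by simpa using hs
    have h₃ := (summable_norm_sum_mul_antidiagonal_of_summable_norm h₁ h₂).of_norm
    calc ∑' n, ‖PowerSeries.coeff n (A ^ (k + 1)) * z ^ n‖
        ≤ ∑' n, ∑ p ∈ Finset.HasAntidiagonal.antidiagonal n, ‖PowerSeries.coeff p.1 (A ^ k) * z ^ p.1‖ *
            ‖PowerSeries.coeff p.2 A * z ^ p.2‖ := by
          refine (summable_norm_coeff_pow hs (k + 1)).tsum_le_tsum (fun n => ?_) h₃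
          rw [coeff_pow_succ_mul]
          refine (norm_sum_le _ _).trans (le_of_eq (Finset.sum_congr rfl fun p _ => norm_mul _ _))
      _ = (∑' n, ‖PowerSeries.coeff n (A ^ k) * z ^ n‖) *
            ∑' n, ‖PowerSeries.coeff n A * z ^ n‖ :=
          (tsum_mul_tsum_eq_tsum_sum_antidiagonal_of_summable_norm h₁ h₂).symm
      _ ≤ _ := by
          rw [pow_succ]
          exact mul_le_mul_of_nonneg_right ih (tsum_nonneg fun _ => norm_nonneg _)

/-- The double series of the terms of `A^k / k!` converges absolutely, because the norms for fixed
`k` sum to at most `S^k / k!`, where `S` is the sum of the norms for `A`. Summation by `k` gives the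
exponential, by `n` the substituted series. -/
theorem hasSum_exp_subst (h₀ : PowerSeries.constantCoeff A = 0)
    (hs : Summable fun n => ‖PowerSeries.coeff n A * z ^ n‖) :
    HasSum (fun n => PowerSeries.coeff n ((PowerSeries.exp ℂ).subst A) * z ^ n)
      (Complex.exp (∑' n, PowerSeries.coeff n A * z ^ n)) := by
  have hsub : PowerSeries.HasSubst A := PowerSeries.HasSubst.of_constantCoeff_zero' h₀
  let f : ℕ × ℕ → ℂ := fun p =>
    (p.1.factorial : ℂ)⁻¹ * (PowerSeries.coeff p.2 (A ^ p.1) * z ^ p.2)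
  have hf : Summable f := by
    rw [← summable_norm_iff, summable_prod_of_nonneg fun _ => norm_nonneg _]
    constructor
    · intro k
      simp only [f, norm_mul _ (_ * _)]
      exact (summable_norm_coeff_pow hs k).mul_left _
    · refine Summable.of_nonneg_of_le (fun k => tsum_nonneg fun _ => norm_nonneg _) (fun k => ?_)
        (Real.summable_pow_div_factorial (∑' n, ‖PowerSeries.coeff n A * z ^ n‖))
      simp only [f, norm_mul _ (_ * _)]
      rw [tsum_mul_left, norm_inv, Complex.norm_natCast, div_eq_inv_mul]
      exact mul_le_mul_of_nonneg_left (tsum_norm_coeff_pow_le hs k) (by positivity)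
  have h₁ : HasSum (fun k : ℕ => (k.factorial : ℂ)⁻¹ * (∑' n, PowerSeries.coeff n A * z ^ n) ^ k)
      (∑' p, f p) := by
    refine hf.hasSum.prod_fiberwise fun k => ?_
    rw [← tsum_coeff_pow hs k]
    have h : Summable fun n => PowerSeries.coeff n (A ^ k) * z ^ n :=
      Summable.of_norm (summable_norm_coeff_pow hs k)
    exact HasSum.mul_left (k.factorial : ℂ)⁻¹ h.hasSum
  have h₂ : ∑' p, f p = Complex.exp (∑' n, PowerSeries.coeff n A * z ^ n) := by
    refine h₁.unique ?_
    have := NormedSpace.expSeries_div_hasSum_exp (∑' n, PowerSeries.coeff n A * z ^ n)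
    rw [← Complex.exp_eq_exp_ℂ] at this
    simpa only [div_eq_inv_mul] using this
  rw [← h₂]
  have hswap : HasSum (fun p : ℕ × ℕ => f p.swap) (∑' p, f p) :=
    (Equiv.prodComm ℕ ℕ).hasSum_iff.2 hf.hasSum
  refine hswap.prod_fiberwise fun n => ?_
  rw [PowerSeries.coeff_subst' hsub]
  have hfin := PowerSeries.coeff_subst_finite' hsub (PowerSeries.exp ℂ) n
  have h₃ := (summable_of_hasFiniteSupport (L := .unconditional ℕ) hfin).hasSum.mul_right (z ^ n)
  rw [tsum_eq_finsum hfin] at h₃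
  have h₄ : (fun k => f (n, k).swap) = fun k =>
      PowerSeries.coeff k (PowerSeries.exp ℂ) • PowerSeries.coeff n (A ^ k) * z ^ n := by
    funext k
    simp [f, PowerSeries.coeff_exp, mul_assoc]
  rw [h₄]
  exact h₃

end Exp

/-! ### Sums over the fibres of a map to the natural numbers -/

theorem hasSum_tsum_fiber {ι : Type*} {f : ι → ℂ} (idx : ι → ℕ) (hf : Summable f) :
    HasSum (fun n => ∑' i : {i // idx i = n}, f i) (∑' i, f i) ∧
      Summable fun n => ‖∑' i : {i // idx i = n}, f i‖ := by
  have h₁ : Summable fun x : Σ n, {i // idx i = n} => f x.2 :=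
    (Equiv.sigmaFiberEquiv idx).summable_iff.2 hf
  have h₂ : ∑' x : Σ n, {i // idx i = n}, f x.2 = ∑' i, f i :=
    (Equiv.sigmaFiberEquiv idx).tsum_eq f
  constructor
  · rw [← h₂]
    exact h₁.hasSum.sigma fun n => (h₁.sigma_factor n).hasSum
  · have h₃ := h₁.norm
    refine Summable.of_nonneg_of_le (fun _ => norm_nonneg _) (fun n => ?_) h₃.sigma
    exact norm_tsum_le_tsum_norm (h₃.sigma_factor n)

/-! ### The product formula for the zeta function -/

theorem exists_four_pow_mul_le {ρ : ℝ} (h₀ : 0 ≤ ρ) (h₁ : ρ < 1) :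
    ∃ C : ℝ, ∀ s : ℕ, 4 ^ s * ρ ^ (s * s) ≤ C := by
  obtain ⟨N, hN⟩ := exists_pow_lt_of_lt_one (by norm_num : (0 : ℝ) < 1 / 4) h₁
  refine ⟨4 ^ N, fun s => ?_⟩
  rcases le_total s N with h | h
  · calc (4 : ℝ) ^ s * ρ ^ (s * s) ≤ 4 ^ s * 1 := by
          gcongr
          exact pow_le_one₀ h₀ h₁.le
      _ ≤ 4 ^ N := by
          rw [mul_one]
          exact pow_le_pow_right₀ (by norm_num) h
  · rw [pow_mul, ← mul_pow]
    have h₂ : 4 * ρ ^ s ≤ 1 := by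
      have := pow_le_pow_of_le_one h₀ h₁.le h
      linarith
    exact (pow_le_one₀ (by positivity) h₂).trans (one_le_pow₀ (by norm_num))

/-- The numbering of the subgroups by triples bounds the sum by a product of three geometric series
in `q`. -/
theorem summable_pow_index {q : ℝ} (h₀ : 0 ≤ q) (h₁ : q < 1) :
    Summable fun K : FinIdx (ℤ × ℤ) => (q ^ 3) ^ K.1.index := by
  obtain ⟨φ, hφ, hle⟩ := exists_injective_finIdx
  have hg := summable_geometric_of_lt_one h₀ h₁
  have hnn : ∀ n : ℕ, 0 ≤ q ^ n := fun n => pow_nonneg h₀ n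
  have h₂ : Summable fun p : ℕ × ℕ × ℕ => q ^ p.1 * (q ^ p.2.1 * q ^ p.2.2) :=
    hg.mul_of_nonneg (hg.mul_of_nonneg hg hnn hnn) hnn fun p => mul_nonneg (hnn _) (hnn _)
  refine Summable.of_nonneg_of_le (fun K => by positivity) (fun K => ?_) (h₂.comp_injective hφ)
  rw [Function.comp_apply, ← pow_add, ← pow_add, ← pow_mul, ← add_assoc]
  exact pow_le_pow_of_le_one h₀ h₁.le (hle K)

theorem summable_planeCount_mul_pow {r : ℝ} (h₀ : 0 ≤ r) (h₁ : r < 1) :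
    Summable fun K : FinIdx (ℤ × ℤ) => (planeCount K.1 : ℝ) * r ^ K.1.index := by
  -- With `r = q^3 q^3`, one factor absorbs the growth `4^√[K]` and the other ensures summability
  -- over `K`.
  obtain ⟨q, hq₀, hq₁, hq⟩ : ∃ q : ℝ, 0 ≤ q ∧ q < 1 ∧ q ^ 6 = r :=
    ⟨r ^ ((1 : ℝ) / 6), by positivity, Real.rpow_lt_one h₀ h₁ (by norm_num), by
      rw [← Real.rpow_natCast, ← Real.rpow_mul h₀]
      norm_num⟩
  have hρ₁ : q ^ 3 < 1 := pow_lt_one₀ hq₀ hq₁ (by norm_num)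
  have hρ₀ : 0 ≤ q ^ 3 := by positivity
  obtain ⟨C, hC⟩ := exists_four_pow_mul_le hρ₀ hρ₁
  refine Summable.of_nonneg_of_le (fun K => by positivity) (fun K => ?_)
    ((summable_pow_index hq₀ hq₁).mul_left C)
  have h₂ : (planeCount K.1 : ℝ) ≤ 4 ^ Nat.sqrt K.1.index := by
    have := planeCount_le_sqrt K.2
    rw [pow_mul] at this
    exact_mod_cast this
  have h₃ : (q ^ 3) ^ K.1.index ≤ (q ^ 3) ^ (Nat.sqrt K.1.index * Nat.sqrt K.1.index) :=
    pow_le_pow_of_le_one hρ₀ hρ₁.le (Nat.sqrt_le _)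
  have h₄ : r ^ K.1.index = (q ^ 3) ^ K.1.index * (q ^ 3) ^ K.1.index := by
    rw [← mul_pow, ← pow_add, ← hq]
  rw [h₄, ← mul_assoc]
  refine mul_le_mul_of_nonneg_right (le_trans ?_ (hC (Nat.sqrt K.1.index))) (by positivity)
  exact mul_le_mul h₂ h₃ (by positivity) (by positivity)

/-- The reciprocal of the zeta function: the product of the `1 - F(K) z^[K]`, where `K` runs through
the subgroups of finite index in `ℤ^2`. -/
def zetaInv (z : ℂ) : ℂ :=
  ∏' K : FinIdx (ℤ × ℤ), (1 + -((planeCount K.1 : ℂ) * z ^ K.1.index))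

theorem summable_norm_factor {z : ℂ} (hz : ‖z‖ < 1) :
    Summable fun K : FinIdx (ℤ × ℤ) => ‖(planeCount K.1 : ℂ) * z ^ K.1.index‖ := by
  simpa only [norm_mul, norm_pow, Complex.norm_natCast] using
    summable_planeCount_mul_pow (norm_nonneg z) hz

theorem hasProd_zetaInv {z : ℂ} (hz : ‖z‖ < 1) :
    HasProd (fun K : FinIdx (ℤ × ℤ) => 1 + -((planeCount K.1 : ℂ) * z ^ K.1.index))
      (zetaInv z) := by
  refine (multipliable_one_add_of_summable ?_).hasProd
  simpa only [norm_neg] using summable_norm_factor hz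

theorem zetaInv_zero : zetaInv 0 = 1 := by
  rw [zetaInv]
  convert tprod_one with K
  rw [zero_pow K.2, mul_zero, neg_zero, add_zero]

theorem zetaInv_eq_zero {z : ℂ} (K : FinIdx (ℤ × ℤ))
    (h : (planeCount K.1 : ℂ) * z ^ K.1.index = 1) : zetaInv z = 0 :=
  tprod_of_exists_eq_zero ⟨K, by rw [h, add_neg_cancel]⟩

theorem differentiableOn_zetaInv : DifferentiableOn ℂ zetaInv (Metric.ball 0 1) := by
  intro z hz
  rw [mem_ball_zero_iff] at hz
  obtain ⟨r, hzr, hr⟩ := exists_between hz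
  have h₀ : 0 ≤ r := (norm_nonneg z).trans hzr.le
  have h := Summable.hasProdLocallyUniformlyOn_one_add (K := Metric.ball (0 : ℂ) r)
    (f := fun (K : FinIdx (ℤ × ℤ)) (z : ℂ) => -((planeCount K.1 : ℂ) * z ^ K.1.index))
    Metric.isOpen_ball (summable_planeCount_mul_pow h₀ hr)
    (Eventually.of_forall fun K x hx => by
      rw [mem_ball_zero_iff] at hx
      rw [norm_neg, norm_mul, norm_pow, Complex.norm_natCast]
      gcongr) (fun K => by fun_prop)
  rw [hasProdLocallyUniformlyOn_iff_tendstoLocallyUniformlyOn] at h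
  have hd := h.differentiableOn (Eventually.of_forall fun s => by fun_prop) Metric.isOpen_ball
  have hmem : Metric.ball (0 : ℂ) r ∈ 𝓝 z := Metric.isOpen_ball.mem_nhds (mem_ball_zero_iff.2 hzr)
  exact ((hd.differentiableAt hmem)).differentiableWithinAt

theorem analyticOnNhd_zetaInv : AnalyticOnNhd ℂ zetaInv (Metric.ball 0 1) :=
  differentiableOn_zetaInv.analyticOnNhd Metric.isOpen_ball

/-! ### The logarithm of the zeta function -/

section Sum

variable {z : ℂ}

theorem norm_factor_pow_three_le (hz : 4 * ‖z‖ ^ 3 ≤ 1) (K : FinIdx (ℤ × ℤ)) :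
    ‖(planeCount K.1 : ℂ) * z ^ K.1.index‖ ^ 3 ≤ 4 * ‖z‖ ^ 3 := by
  have h : (planeCount K.1 : ℝ) ^ 3 ≤ 4 ^ K.1.index := by
    exact_mod_cast planeCount_pow_three_le K.2
  rw [norm_mul, norm_pow, Complex.norm_natCast, mul_pow, ← pow_mul, mul_comm _ 3, pow_mul]
  calc (planeCount K.1 : ℝ) ^ 3 * (‖z‖ ^ 3) ^ K.1.index
      ≤ 4 ^ K.1.index * (‖z‖ ^ 3) ^ K.1.index := by gcongr
    _ = (4 * ‖z‖ ^ 3) ^ K.1.index := by rw [mul_pow]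
    _ ≤ 4 * ‖z‖ ^ 3 := pow_le_of_le_one (by positivity) hz K.2

/-- A bound uniform in `K` keeps every `1 - F(K) z^[K]` away from 0 and controls all the logarithm
series at once. -/
theorem exists_norm_factor_le (hz : 4 * ‖z‖ ^ 3 < 1) :
    ∃ q < 1, ∀ K : FinIdx (ℤ × ℤ), ‖(planeCount K.1 : ℂ) * z ^ K.1.index‖ ≤ q := by
  have h₀ : 0 ≤ 4 * ‖z‖ ^ 3 := by positivity
  refine ⟨(4 * ‖z‖ ^ 3) ^ ((1 : ℝ) / 3), Real.rpow_lt_one h₀ hz (by norm_num), fun K => ?_⟩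
  refine le_of_pow_le_pow_left₀ (n := 3) (by norm_num) (by positivity) ?_
  refine (norm_factor_pow_three_le hz.le K).trans (le_of_eq ?_)
  generalize 4 * ‖z‖ ^ 3 = δ at h₀
  rw [← Real.rpow_natCast, ← Real.rpow_mul h₀]
  norm_num

theorem norm_lt_one_of_four_mul (hz : 4 * ‖z‖ ^ 3 < 1) : ‖z‖ < 1 := by
  by_contra! h
  have := one_le_pow₀ h (n := 3)
  linarith

/-- Applied to the `m = [K]` cosets `t`: the term does not depend on `t`, and the weights `1 / m`
add up to 1. -/
theorem hasSum_prod_const {ι : Type*} [Finite ι] {f : ℕ → ℂ} {a : ℂ} (hf : HasSum f a)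
    {m : ℕ} (hm : Nat.card ι = m) (hm₀ : m ≠ 0) :
    HasSum (fun p : ℕ × ι => f p.1 / m) a := by
  have := Fintype.ofFinite ι
  have hm' : (m : ℂ) ≠ 0 := Nat.cast_ne_zero.2 hm₀
  have h₁ : HasSum (fun _ : ι => (m : ℂ)⁻¹) 1 := by
    have h := hasSum_fintype (fun _ : ι => (m : ℂ)⁻¹)
    rwa [Finset.sum_const, Finset.card_univ, ← Nat.card_eq_fintype_card, hm, nsmul_eq_mul,
      mul_inv_cancel₀ hm'] at h
  have hs : Summable fun p : ℕ × ι => f p.1 * (m : ℂ)⁻¹ :=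
    summable_mul_of_summable_norm (f := f) (g := fun _ : ι => (m : ℂ)⁻¹)
      hf.summable.norm h₁.summable.norm
  have h₂ := HasSum.mul hf h₁ hs
  rwa [mul_one] at h₂

/-- The terms of the logarithm of the zeta function. -/
def logTerm (z : ℂ) (x : TowerData (ℤ × ℤ)) : ℂ :=
  ((planeCount x.1.1 : ℂ) * z ^ x.1.1.index) ^ (x.2.1 + 1) / ((x.2.1 : ℂ) + 1) / x.1.1.index

theorem norm_logTerm_le (z : ℂ) (x : TowerData (ℤ × ℤ)) :
    ‖logTerm z x‖ ≤
      ‖(planeCount x.1.1 : ℂ) * z ^ x.1.1.index‖ ^ (x.2.1 + 1) / x.1.1.index := by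
  rw [logTerm, norm_div, norm_div, norm_pow, Complex.norm_natCast]
  gcongr
  refine div_le_self (by positivity) ?_
  have : ((x.2.1 : ℂ) + 1) = ((x.2.1 + 1 : ℕ) : ℂ) := by push_cast; rfl
  rw [this, Complex.norm_natCast]
  exact_mod_cast Nat.succ_le_succ (Nat.zero_le _)

theorem summable_logTerm (hz : 4 * ‖z‖ ^ 3 < 1) : Summable (logTerm z) := by
  obtain ⟨q, hq₁, hq⟩ := exists_norm_factor_le hz
  have hinner : ∀ K : FinIdx (ℤ × ℤ), HasSum (fun p : ℕ × ((ℤ × ℤ) ⧸ K.1) =>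
      ‖(planeCount K.1 : ℂ) * z ^ K.1.index‖ ^ (p.1 + 1) / K.1.index)
      (‖(planeCount K.1 : ℂ) * z ^ K.1.index‖ *
        (1 - ‖(planeCount K.1 : ℂ) * z ^ K.1.index‖)⁻¹) := by
    intro K
    have := finite_quotient K.2
    have h₁ := (hasSum_geometric_of_lt_one (norm_nonneg _) ((hq K).trans_lt hq₁)).mul_left
      ‖(planeCount K.1 : ℂ) * z ^ K.1.index‖
    simp only [← pow_succ'] at h₁
    rw [← Complex.hasSum_ofReal] at h₁ ⊢
    have h₂ := hasSum_prod_const (ι := (ℤ × ℤ) ⧸ K.1) h₁ rfl K.2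
    convert h₂ using 2 with p
    push_cast
    rfl
  refine Summable.of_norm_bounded (g := fun x : TowerData (ℤ × ℤ) =>
    ‖(planeCount x.1.1 : ℂ) * z ^ x.1.1.index‖ ^ (x.2.1 + 1) / x.1.1.index) ?_ (norm_logTerm_le z)
  rw [summable_sigma_of_nonneg fun x => by positivity]
  refine ⟨fun K => (hinner K).summable, ?_⟩
  simp only [fun K => (hinner K).tsum_eq]
  have hz₁ := norm_lt_one_of_four_mul hz
  refine Summable.of_nonneg_of_le (fun K => ?_) (fun K => ?_)
    ((summable_norm_factor hz₁).mul_right (1 - q)⁻¹)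
  · have := hq K
    exact mul_nonneg (norm_nonneg _) (inv_nonneg.2 (by linarith))
  · have := hq K
    gcongr

/-- For fixed `K` the sum over `c` and `t` is `-log (1 - F(K) z^[K])`. Exponentiating the sum over
`K` cancels the product factor by factor, whatever the branch of the logarithm. -/
theorem exp_tsum_logTerm_mul (hz : 4 * ‖z‖ ^ 3 < 1) :
    Complex.exp (∑' x, logTerm z x) * zetaInv z = 1 := by
  obtain ⟨q, hq₁, hq⟩ := exists_norm_factor_le hz
  have h₁ : HasSum (fun K : FinIdx (ℤ × ℤ) =>
      -Complex.log (1 - (planeCount K.1 : ℂ) * z ^ K.1.index)) (∑' x, logTerm z x) := by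
    refine (summable_logTerm hz).hasSum.sigma fun K => ?_
    have := finite_quotient K.2
    have h := Complex.hasSum_taylorSeries_neg_log' ((hq K).trans_lt hq₁)
    have h' := hasSum_prod_const (ι := (ℤ × ℤ) ⧸ K.1) (m := K.1.index) h rfl K.2
    simpa only [logTerm] using h'
  have h₂ := h₁.cexp.mul (hasProd_zetaInv (norm_lt_one_of_four_mul hz))
  refine h₂.unique ?_
  convert hasProd_one with K
  have hne : (1 - (planeCount K.1 : ℂ) * z ^ K.1.index) ≠ 0 := by
    intro h
    rw [sub_eq_zero] at h
    have := (hq K).trans_lt hq₁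
    rw [← h, norm_one] at this
    exact lt_irrefl _ this
  rw [Function.comp_apply, Complex.exp_neg, Complex.exp_log hne, ← sub_eq_add_neg,
    inv_mul_cancel₀ hne]

theorem coeff_logZeta_mul (z : ℂ) (n : ℕ) :
    PowerSeries.coeff n (logZeta 3 ledrappierExt) * z ^ n =
      ∑' x : {x : TowerData (ℤ × ℤ) // (latticeEquiv x).1.index = n}, logTerm z x := by
  rw [logZeta, PowerSeries.coeff_mk, ← finsum_set_coe_eq_finsum_mem]
  have := (finite_index_eq 3 n).to_subtype
  let e : {x : TowerData (ℤ × ℤ) // (latticeEquiv x).1.index = n} ≃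
      {Λ : AddSubgroup (Fin 3 → ℤ) | Λ.FiniteIndex ∧ Λ.index = n} :=
    { toFun := fun x => ⟨(latticeEquiv x.1).1, ⟨(latticeEquiv x.1).2⟩, x.2⟩
      invFun := fun Λ => ⟨latticeEquiv.symm ⟨Λ.1, Λ.2.1.index_ne_zero⟩, by
        rw [Equiv.apply_symm_apply]
        exact Λ.2.2⟩
      left_inv := fun x => Subtype.ext (latticeEquiv.symm_apply_apply x.1)
      right_inv := fun Λ => by
        apply Subtype.ext
        dsimp only
        rw [Equiv.apply_symm_apply] }
  rw [← tsum_eq_finsum (L := .unconditional _) (Set.toFinite _), ← e.tsum_eq, ← tsum_mul_right]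
  refine tsum_congr fun x => ?_
  have h₁ : (e x).1 = (latticeEquiv x.1).1 := rfl
  have h₂ := (index_latticeEquiv x.1).symm.trans x.2
  rw [h₁, periodicCount_latticeEquiv, index_latticeEquiv, logTerm, mul_pow, ← pow_mul, h₂]
  have h₃ : (n : ℂ) = x.1.1.1.index * ((x.1.2.1 : ℂ) + 1) := by
    exact_mod_cast h₂.symm
  push_cast
  rw [div_div, mul_comm ((x.1.2.1 : ℂ) + 1), div_mul_eq_mul_div, h₃]

theorem constantCoeff_logZeta : PowerSeries.constantCoeff (logZeta 3 ledrappierExt) = 0 := by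
  have h := coeff_logZeta_mul 1 0
  rw [pow_zero, mul_one, PowerSeries.coeff_zero_eq_constantCoeff_apply] at h
  rw [h]
  have : IsEmpty {x : TowerData (ℤ × ℤ) // (latticeEquiv x).1.index = 0} :=
    ⟨fun x => (latticeEquiv x.1).2 x.2⟩
  exact tsum_empty

/-- The zeta function is the reciprocal of the product. -/
theorem hasSum_zeta (hz : 4 * ‖z‖ ^ 3 < 1) :
    HasSum (fun n => PowerSeries.coeff n (zeta 3 ledrappierExt) * z ^ n) (zetaInv z)⁻¹ := by
  obtain ⟨h₁, h₂⟩ := hasSum_tsum_fiber (fun x => (latticeEquiv x).1.index) (summable_logTerm hz)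
  simp only [← coeff_logZeta_mul] at h₁ h₂
  have h₃ := hasSum_exp_subst constantCoeff_logZeta h₂
  rw [h₁.tsum_eq] at h₃
  rwa [← eq_inv_of_mul_eq_one_left (exp_tsum_logTerm_mul hz)]

end Sum

/-! ### The radius of convergence -/

/-- The radius of convergence of the zeta function. -/
def critRadius : ℝ := (2 : ℝ) ^ (-(2 / 3) : ℝ)

theorem critRadius_pos : 0 < critRadius := Real.rpow_pos_of_pos two_pos _

theorem four_mul_critRadius_pow : 4 * critRadius ^ 3 = 1 := by
  rw [critRadius, ← Real.rpow_natCast, ← Real.rpow_mul two_pos.le]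
  norm_num

theorem critRadius_lt_one : critRadius < 1 :=
  Real.rpow_lt_one_of_one_lt_of_neg one_lt_two (by norm_num)

theorem four_mul_pow_lt {r : ℝ} (h₀ : 0 ≤ r) (hr : r < critRadius) : 4 * r ^ 3 < 1 := by
  rw [← four_mul_critRadius_pow]
  gcongr

theorem zetaInv_critRadius : zetaInv critRadius = 0 := by
  refine zetaInv_eq_zero ⟨modThree.ker, by rw [index_ker_modThree]; norm_num⟩ ?_
  rw [planeCount_ker_modThree, index_ker_modThree]
  exact_mod_cast four_mul_critRadius_pow

theorem critRadius_le_zetaRadius : ENNReal.ofReal critRadius ≤ zetaRadius 3 ledrappierExt := by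
  refine le_of_forall_lt fun r hr => ?_
  obtain ⟨s, hrs, hs⟩ := ENNReal.lt_iff_exists_nnreal_btwn.1 hr
  refine hrs.trans_le ?_
  have hs' : (s : ℝ) < critRadius := by
    rw [← ENNReal.ofReal_coe_nnreal] at hs
    exact (ENNReal.ofReal_lt_ofReal_iff critRadius_pos).1 hs
  refine FormalMultilinearSeries.le_radius_of_summable_norm _ ?_
  have hn : ‖((s : ℝ) : ℂ)‖ = s := by simp
  have h := (hasSum_zeta (z := ((s : ℝ) : ℂ)) (by
    rw [hn]
    exact four_mul_pow_lt s.2 hs')).summable.norm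
  simpa only [FormalMultilinearSeries.ofScalars_norm, norm_mul, norm_pow, hn] using h

/-- With a larger radius the series would be continuous at `critRadius`. Its product with `zetaInv`
is 1 to the left of that point, where `zetaInv` tends to 0 because of the factor `1 - 4 z^3`. -/
theorem zetaRadius_le_critRadius : zetaRadius 3 ledrappierExt ≤ ENNReal.ofReal critRadius := by
  by_contra! hlt
  let c : ℕ → ℂ := fun n => PowerSeries.coeff n (zeta 3 ledrappierExt)
  let p := FormalMultilinearSeries.ofScalars ℂ c
  have hp : HasFPowerSeriesOnBall p.sum p 0 p.radius :=
    p.hasFPowerSeriesOnBall ((ENNReal.ofReal_pos.2 critRadius_pos).trans hlt)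
  have hmem : ((critRadius : ℝ) : ℂ) ∈ Metric.eball (0 : ℂ) p.radius := by
    rw [Metric.mem_eball, edist_zero_right, ← ofReal_norm, Complex.norm_real,
      Real.norm_of_nonneg critRadius_pos.le]
    exact hlt
  have hc : ContinuousAt p.sum ((critRadius : ℝ) : ℂ) :=
    (hp.continuousOn).continuousAt (Metric.isOpen_eball.mem_nhds hmem)
  have hP : ContinuousAt zetaInv ((critRadius : ℝ) : ℂ) := by
    refine (analyticOnNhd_zetaInv _ ?_).continuousAt
    rw [mem_ball_zero_iff, Complex.norm_real, Real.norm_of_nonneg critRadius_pos.le]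
    exact critRadius_lt_one
  have hlim : Tendsto (fun r : ℝ => p.sum r * zetaInv r) (𝓝[<] critRadius)
      (𝓝 (p.sum critRadius * zetaInv critRadius)) :=
    ((hc.mul hP).tendsto.comp (Complex.continuous_ofReal.tendsto critRadius)).mono_left
      nhdsWithin_le_nhds
  have hone : ∀ᶠ r : ℝ in 𝓝[<] critRadius, (1 : ℂ) = p.sum r * zetaInv r := by
    filter_upwards [Ioo_mem_nhdsLT critRadius_pos] with r hr
    have h4 : 4 * ‖(r : ℂ)‖ ^ 3 < 1 := by
      rw [Complex.norm_real, Real.norm_of_nonneg hr.1.le]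
      exact four_mul_pow_lt hr.1.le hr.2
    have h₁ : p.sum r = (zetaInv r)⁻¹ := by
      rw [← (hasSum_zeta h4).tsum_eq]
      exact FormalMultilinearSeries.ofScalars_sum_eq c (r : ℂ)
    have h₂ : zetaInv r ≠ 0 := right_ne_zero_of_mul_eq_one (exp_tsum_logTerm_mul h4)
    rw [h₁, inv_mul_cancel₀ h₂]
  have h := tendsto_nhds_unique (tendsto_const_nhds.congr' hone) hlim
  rw [zetaInv_critRadius, mul_zero] at h
  exact one_ne_zero h

/-! ### Poles and the natural boundary -/

/-- By the identity theorem infinite order would force `zetaInv` to vanish on the disc, against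
`zetaInv 0 = 1`. -/
theorem analyticOrderAt_zetaInv_ne_top {z : ℂ} (hz : z ∈ Metric.ball (0 : ℂ) 1) :
    analyticOrderAt zetaInv z ≠ ⊤ := by
  intro h
  have h₁ := analyticOnNhd_zetaInv.eqOn_zero_of_preconnected_of_eventuallyEq_zero
    (convex_ball (0 : ℂ) 1).isPreconnected hz (analyticOrderAt_eq_top.1 h)
  have h₂ := h₁ (Metric.mem_ball_self one_pos)
  rw [zetaInv_zero] at h₂
  exact one_ne_zero h₂

theorem meromorphicOrderAt_inv_zetaInv_neg {z : ℂ} (hz : z ∈ Metric.ball (0 : ℂ) 1)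
    (h₀ : zetaInv z = 0) : meromorphicOrderAt zetaInv⁻¹ z < 0 := by
  have ha := analyticOnNhd_zetaInv z hz
  rw [meromorphicOrderAt_inv, ha.meromorphicOrderAt_eq]
  have h₁ : analyticOrderAt zetaInv z ≠ 0 := ha.analyticOrderAt_ne_zero.2 h₀
  obtain ⟨n, hn⟩ := ENat.ne_top_iff_exists.1 (analyticOrderAt_zetaInv_ne_top hz)
  rw [← hn] at h₁ ⊢
  have hn0 : n ≠ 0 := fun h => h₁ (by rw [h]; rfl)
  have : -(((n : ℕ) : ℤ) : WithTop ℤ) = ((-(n : ℤ) : ℤ) : WithTop ℤ) := rfl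
  rw [ENat.map_natCast, this]
  exact_mod_cast (by omega : -(n : ℤ) < 0)

theorem exists_zero_near {w : ℂ} (hw : w ∈ Metric.sphere (0 : ℂ) 1) {ε : ℝ} (hε : 0 < ε) :
    ∃ z ∈ Metric.ball (0 : ℂ) 1, dist z w < ε ∧ zetaInv z = 0 := by
  -- The zero will be `w * exp x` with `‖x‖ ≤ 9 / s` and `s > N`-type size: 9 makes `‖x‖ ≤ 1`, as
  -- `‖exp x - 1‖ ≤ 2 ‖x‖` requires, and `18 / ε` makes the resulting distance less than `ε`.
  obtain ⟨N, hN⟩ := exists_nat_gt (max 9 (18 / ε))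
  obtain ⟨K, hKN, hK⟩ := exists_four_le_planeCount (N * N)
  have hm0 : K.index ≠ 0 := by omega
  have hle := planeCount_le_sqrt hm0
  set m := K.index
  set F := planeCount K
  set s := Nat.sqrt m
  have hNs : N ≤ s := Nat.le_sqrt.2 hKN.le
  have hsm : s * s ≤ m := Nat.sqrt_le m
  have hs9 : (9 : ℝ) < s := ((le_max_left _ _).trans_lt hN).trans_le (by exact_mod_cast hNs)
  have hsε : 18 / ε < s := ((le_max_right _ _).trans_lt hN).trans_le (by exact_mod_cast hNs)
  have hs0 : (0 : ℝ) < s := by linarith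
  have hmR : (s : ℝ) * s ≤ m := by exact_mod_cast hsm
  have hm : (0 : ℝ) < m := lt_of_lt_of_le (by positivity) hmR
  have hF4 : (4 : ℝ) ≤ F := by exact_mod_cast hK
  have hF : (0 : ℝ) < F := by linarith
  have hlog0 : 0 < Real.log F := Real.log_pos (by linarith)
  have hlog : Real.log F ≤ 2 * s := by
    have h₁ : (F : ℝ) ≤ 2 ^ (2 * s) := by exact_mod_cast hle
    have h₂ := Real.log_le_log hF h₁
    rw [Real.log_pow] at h₂
    push_cast at h₂
    have h₃ := Real.log_two_lt_d9
    nlinarith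
  have hwn : ‖w‖ = 1 := mem_sphere_zero_iff_norm.1 hw
  obtain ⟨θ, hθ⟩ : ∃ θ : ℝ, Complex.exp (θ * Complex.I) = w :=
    ⟨Complex.arg w, by
      have := Complex.norm_mul_exp_arg_mul_I w
      rwa [hwn, Complex.ofReal_one, one_mul] at this⟩
  -- Selects an `m`-th root of unity whose argument is within `2 π / m`, hence within `7 / s`, of
  -- `θ`. The radius is `exp a = F^(-1/m)`, and `|a| ≤ 2 / s` by the square-root bound.
  let k : ℤ := ⌊θ * m / (2 * Real.pi)⌋
  have hpi := Real.pi_pos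
  let a : ℝ := -(Real.log F / m)
  let b : ℝ := 2 * Real.pi * k / m
  have ha : |a| ≤ 2 / s := by
    rw [abs_neg, abs_of_pos (by positivity), div_le_div_iff₀ hm hs0]
    nlinarith
  have hb : |b - θ| ≤ 7 / s := by
    have h₁ : (k : ℝ) ≤ θ * m / (2 * Real.pi) := Int.floor_le _
    have h₂ : θ * m / (2 * Real.pi) < k + 1 := Int.lt_floor_add_one _
    rw [le_div_iff₀ (by positivity)] at h₁
    rw [div_lt_iff₀ (by positivity)] at h₂
    have h₃ : b - θ = (2 * Real.pi * k - θ * m) / m := by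
      simp only [b]
      field_simp
    rw [h₃, abs_div, abs_of_pos hm, div_le_div_iff₀ hm hs0]
    have h₄ : |2 * Real.pi * k - θ * m| ≤ 7 := by
      rw [abs_le]
      have := Real.pi_lt_d2
      constructor <;> nlinarith
    have h₅ : (s : ℝ) ≤ m := by nlinarith
    nlinarith [abs_nonneg (2 * Real.pi * k - θ * m)]
  let x : ℂ := a + (b - θ : ℝ) * Complex.I
  have hx : ‖x‖ ≤ 9 / s := by
    calc ‖x‖ ≤ ‖(a : ℂ)‖ + ‖((b - θ : ℝ) : ℂ) * Complex.I‖ := norm_add_le _ _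
      _ = |a| + |b - θ| := by
        rw [norm_mul, Complex.norm_I, mul_one, Complex.norm_real, Complex.norm_real,
          Real.norm_eq_abs, Real.norm_eq_abs]
      _ ≤ 2 / s + 7 / s := add_le_add ha hb
      _ = 9 / s := by ring
  have hx1 : ‖x‖ ≤ 1 := hx.trans ((div_le_one hs0).2 hs9.le)
  let z : ℂ := Complex.exp (a + b * Complex.I)
  have hzx : z = w * Complex.exp x := by
    simp only [z, x]
    rw [← hθ, ← Complex.exp_add]
    congr 1
    push_cast
    ring
  refine ⟨z, ?_, ?_, ?_⟩
  · rw [mem_ball_zero_iff, Complex.norm_exp]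
    have : ((a : ℂ) + b * Complex.I).re = a := by simp
    rw [this, Real.exp_lt_one_iff]
    simp only [a, Left.neg_neg_iff]
    positivity
  · rw [dist_eq_norm, hzx, ← mul_sub_one, norm_mul, hwn, one_mul]
    refine (Complex.norm_exp_sub_one_le hx1).trans_lt ?_
    have h₁ : 18 / s < ε := by
      rw [div_lt_iff₀ hε] at hsε
      rw [div_lt_iff₀ hs0]
      linarith
    have h₂ : 2 * (9 / (s : ℝ)) = 18 / s := by ring
    linarith
  · refine zetaInv_eq_zero ⟨K, hm0⟩ ?_
    change (F : ℂ) * z ^ m = 1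
    have hmC : (m : ℂ) ≠ 0 := Nat.cast_ne_zero.2 hm0
    have h₁ : (m : ℂ) * (a + b * Complex.I) =
        -((Real.log F : ℝ) : ℂ) + k * (2 * Real.pi * Complex.I) := by
      simp only [a, b]
      push_cast
      field_simp
    have h₂ : Complex.exp ((Real.log F : ℝ) : ℂ) = F := by
      rw [← Complex.ofReal_exp, Real.exp_log hF]
      rfl
    have h₃ : (F : ℂ) ≠ 0 := by exact_mod_cast hF.ne'
    rw [← Complex.exp_nat_mul, h₁, Complex.exp_add, Complex.exp_int_mul_two_pi_mul_I, mul_one,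
      Complex.exp_neg, h₂, mul_inv_cancel₀ h₃]

theorem accPt_poles {w : ℂ} (hw : w ∈ Metric.sphere (0 : ℂ) 1) :
    AccPt w (𝓟 {p ∈ Metric.ball (0 : ℂ) 1 | meromorphicOrderAt zetaInv⁻¹ p < 0}) := by
  rw [accPt_iff_nhds]
  intro U hU
  obtain ⟨ε, hε, hsub⟩ := Metric.mem_nhds_iff.1 hU
  obtain ⟨z, hz, hzw, h₀⟩ := exists_zero_near hw hε
  refine ⟨z, ⟨hsub hzw, hz, meromorphicOrderAt_inv_zetaInv_neg hz h₀⟩, ?_⟩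
  rintro rfl
  rw [mem_ball_zero_iff, mem_sphere_zero_iff_norm.1 hw] at hz
  exact lt_irrefl _ hz

/-- An open set is the domain of existence of a function on it if its poles accumulate at every
boundary point. -/
theorem hasNaturalBoundary_of_accPt {f : ℂ → ℂ} {U : Set ℂ} (hU : IsOpen U)
    (h : ∀ w ∈ frontier U, AccPt w (𝓟 {p ∈ U | meromorphicOrderAt f p < 0})) :
    HasNaturalBoundary f U := by
  intro w hw r hr g hg heq
  have hwb : w ∈ Metric.ball w r := Metric.mem_ball_self hr
  -- `g` is analytic on a punctured neighbourhood of `w`. That contains a pole `p` of `f`, near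
  -- which `f` and `g` agree off `p`, so that the order at `p` would be both negative and
  -- nonnegative.
  have h₁ := (hg w hwb).eventually_analyticAt
  have h₂ : ∀ᶠ z in 𝓝[≠] w, z ∈ Metric.ball w r :=
    nhdsWithin_le_nhds (Metric.isOpen_ball.mem_nhds hwb)
  obtain ⟨p, ⟨hpU, hp⟩, ha, hpb⟩ :=
    ((accPt_iff_frequently_nhdsNE.1 (h w hw)).and_eventually (h₁.and h₂)).exists
  have hopen : Metric.ball w r ∩ U ∈ 𝓝 p := (Metric.isOpen_ball.inter hU).mem_nhds ⟨hpb, hpU⟩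
  have h₃ := mem_codiscreteWithin_iff_forall_mem_nhdsNE.1 heq p ⟨hpb, hpU⟩
  have h₄ : g =ᶠ[𝓝[≠] p] f := by
    filter_upwards [h₃, nhdsWithin_le_nhds hopen] with z hz hz'
    exact hz.resolve_right fun hn => hn hz'
  have h₅ := ha.meromorphicOrderAt_nonneg
  rw [meromorphicOrderAt_congr h₄] at h₅
  exact absurd hp (not_lt.2 h₅)

theorem analyticAt_inv_zetaInv {z : ℂ} (hz : z ∈ Metric.ball (0 : ℂ) 1)
    (h : 0 ≤ meromorphicOrderAt zetaInv⁻¹ z) : AnalyticAt ℂ zetaInv⁻¹ z :=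
  (analyticOnNhd_zetaInv z hz).inv fun h₀ =>
    absurd (meromorphicOrderAt_inv_zetaInv_neg hz h₀) (not_lt.2 h)

end LindZeta

end

theorem mainTheorem10 :
    -- the numbers of periodic points are finite
    (∀ Λ : AddSubgroup (Fin 3 → ℤ), Λ.FiniteIndex →
      (AddAction.fixedPoints Λ LindZeta.ledrappierExt).Finite) ∧
    -- the entropy, the upper growth rate of periodic points, and the radius of convergence
    LindZeta.topologicalEntropy 3 LindZeta.ledrappierExt = 0 ∧
    LindZeta.upperGrowthRate 3 LindZeta.ledrappierExt = ((2 / 3 * Real.log 2 : ℝ) : EReal) ∧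
    LindZeta.zetaRadius 3 LindZeta.ledrappierExt = ENNReal.ofReal ((2 : ℝ) ^ (-(2 / 3) : ℝ)) ∧
    -- the zeta function continues to the open unit disc, analytically up to poles
    ∃ Z : ℂ → ℂ,
      (∀ z : ℂ, ‖z‖ < (2 : ℝ) ^ (-(2 / 3) : ℝ) →
        HasSum (fun n : ℕ =>
          PowerSeries.coeff n (LindZeta.zeta 3 LindZeta.ledrappierExt) * z ^ n) (Z z)) ∧
      MeromorphicOn Z (Metric.ball 0 1) ∧
      (∀ z ∈ Metric.ball (0 : ℂ) 1, 0 ≤ meromorphicOrderAt Z z → AnalyticAt ℂ Z z) ∧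
      -- the poles accumulate at every point of the unit circle, a natural boundary
      (∀ w ∈ Metric.sphere (0 : ℂ) 1,
        AccPt w (𝓟 {p ∈ Metric.ball (0 : ℂ) 1 | meromorphicOrderAt Z p < 0})) ∧
      LindZeta.HasNaturalBoundary Z (Metric.ball 0 1) := by
  refine ⟨fun Λ hΛ => LindZeta.finite_fixedPoints Λ hΛ.index_ne_zero,
    LindZeta.topologicalEntropy_eq_zero, LindZeta.upperGrowthRate_eq,
    le_antisymm LindZeta.zetaRadius_le_critRadius LindZeta.critRadius_le_zetaRadius,
    LindZeta.zetaInv⁻¹,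
    fun z hz => LindZeta.hasSum_zeta (LindZeta.four_mul_pow_lt (norm_nonneg z) hz),
    fun z hz => (LindZeta.analyticOnNhd_zetaInv z hz).meromorphicAt.inv,
    fun z hz => LindZeta.analyticAt_inv_zetaInv hz,
    fun w hw => LindZeta.accPt_poles hw,
    LindZeta.hasNaturalBoundary_of_accPt Metric.isOpen_ball fun w hw => ?_⟩
  rw [frontier_ball (0 : ℂ) one_ne_zero] at hw
  exact LindZeta.accPt_poles hw
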